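/- For a group $G$ and $x\in G$, let $\mathrm{Sub}_G(x)=\langle g\in G \mid \langle x\rangle \text{ is subnormal in } \langle x,g\rangle\rangle$ be the subnormalizer of $x$ in $G$. Let $k\ge 3$ be an integer and let $x\in S_{2^k}$ be a $2$-element (an element whose order is a power of $2$). Then $\mathrm{Sub}_{S_{2^k}}(x)<S_{2^k}$ is a proper subgroup if and only if one of the following holds: (i) $x$ is a $2^k$-cycle; (ii) $o(x)=2^{k-1}$ and $x$ has at least one fixed point on $\{1,\dots,2^k\}$. Moreover, in case (ii), let $\Omega\subseteq\{1,\dots,2^k\}$ be the set of points lying in cycles of $x$ of length smaller than $2^{k-1}$ (fixed points included), and let $y$ be the product of all cycles of length smaller than $2^{k-1}$ in the expression of $x$ as a product of disjoint cycles, regarded as an element of $\mathrm{Sym}(\Omega)$. Then $|\Omega|=2^{k-1}$ and $$\mathrm{Sub}_{S_{2^k}}(x)=\mathrm{Sub}_{\mathrm{Sym}(\Omega)}(y)\wr S_2,$$ where, for $H\le \mathrm{Sym}(\Omega)$, $H\wr S_2\le S_{2^k}$ denotes the imprimitive wreath product with respect to a suitable bijection $e$ from $\Omega$ to its complement: it is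 generated by $H$ (acting on $\Omega$ and fixing the complement pointwise), the copy of $H$ acting on the complement of $\Omega$ via $e$, and the involution exchanging $a$ and $e(a)$ for all $a\in\Omega$. -/

import Mathlib

/-- The subnormalizer `Sub_G(x)`: the subgroup of `G` generated by all `g` such that `⟨x⟩` is a
subnormal subgroup of `⟨x, g⟩`. -/
def subnormalizer {G : Type*} [Group G] (x : G) : Subgroup G :=
  Subgroup.closure
    {g : G | ((Subgroup.zpowers x).subgroupOf (Subgroup.closure {x, g})).IsSubnormal}

/-- The product of the cycles of length smaller than `m` in the decomposition of `x` as a product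
of disjoint cycles. -/
def shortCycleProduct {α : Type*} [Fintype α] [DecidableEq α] (x : Equiv.Perm α) (m : ℕ) :
    Equiv.Perm α :=
  (x.cycleFactorsFinset.filter (fun c => c.support.card < m)).noncommProd id
    (fun _ ha _ hb hab => x.cycleFactorsFinset_mem_commute
      (Finset.mem_filter.mp ha).1 (Finset.mem_filter.mp hb).1 hab)

/-- The set of points lying in a cycle of `x` of length smaller than `m`, where a fixed point is
a cycle of length one. -/
def shortCyclePoints {α : Type*} (x : Equiv.Perm α) (m : ℕ) : Set α :=
  {a | Function.minimalPeriod x a < m}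

/-- For `H ≤ Sym(Ω)` and an identification `f` of `α` with two copies of `Ω` (indexed by the
elements of `S₂`, on which `S₂` acts by multiplication), the subgroup `H ≀ S₂` of `Sym(α)`: two
independent elements of `H` act on the two copies, and `S₂` permutes the copies. -/
def wreathS2 {Ω α : Type*} (H : Subgroup (Equiv.Perm Ω))
    (f : Ω × Equiv.Perm (Fin 2) ≃ α) : Subgroup (Equiv.Perm α) :=
  (f.permCongrHom.toMonoidHom.comp
    (RegularWreathProduct.toPerm H (Equiv.Perm (Fin 2)) Ω)).range

/-!
For a `p`-element `x` of a finite group, `⟨x⟩` is subnormal in `⟨x, g⟩` exactly when `g` normalizes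
a `p`-subgroup containing `x`; so the subnormalizer of `x` is generated by the normalizers of the
`p`-subgroups containing `x`.

* If `x` is transitive, the central involution of `⟨x⟩` acts freely and its orbits are permuted by
  all these normalizers; by induction on the number of points the subnormalizer is a `2`-group.
* If `x` has a cycle on half of the points and a fixed point, then `x` has only two invariant
  sets of half size, `Ω` and its complement, and the subnormalizer preserves the pair. Inside
  `Sym(Ω) ≀ S₂` we have `x = (y, z)` with `z` transitive, and after conjugating by an element of
  the base group `y` lies in the `2`-group `Sub(z)`, which makes the two components symmetric and
  gives the wreath product.
* In all other cases the points split into `x`-invariant halves on which induction applies, and the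
  transpositions obtained generate the symmetric group.
-/

open Subgroup
open scoped Pointwise

section Criterion

variable {G : Type*} [Group G] {p : ℕ}

theorem isPGroup_zpowers_of_pow_eq_one {x : G} {n : ℕ} (hx : x ^ p ^ n = 1) :
    IsPGroup p (zpowers x) := by
  rintro ⟨_, i, rfl⟩
  refine ⟨n, Subtype.ext ?_⟩
  change (x ^ i) ^ p ^ n = 1
  rw [← zpow_natCast, ← zpow_mul, mul_comm, zpow_mul, zpow_natCast, hx, one_zpow]

theorem isSubnormal_of_isNilpotent [Finite G] [Group.IsNilpotent G] (H : Subgroup G) :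
    H.IsSubnormal := by
  induction H using WellFoundedGT.induction with
  | ind H ih =>
    rcases eq_or_ne H ⊤ with rfl | hH
    · exact IsSubnormal.top
    · have hlt := Group.normalizerCondition_of_isNilpotent H hH.lt_top
      exact IsSubnormal.step H _ hlt.le (ih _ hlt) normal_in_normalizer

theorem relIndex_dvd_index_of_normal_right [Finite G] (S N : Subgroup G) [N.Normal] :
    S.relIndex N ∣ S.index := by
  obtain ⟨c, hc⟩ := relIndex_dvd_index_of_normal N S
  have h : S.relIndex N * N.index = N.relIndex S * S.index := by
    rw [← inf_relIndex_right, relIndex_mul_index inf_le_right, ← inf_relIndex_right,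
      relIndex_mul_index inf_le_right, inf_comm]
  refine ⟨c, Nat.eq_of_mul_eq_mul_left (Nat.pos_of_ne_zero
    (FiniteIndex.index_ne_zero (H := N.subgroupOf S))) (h.symm.trans ?_)⟩
  rw [hc]
  exact mul_left_comm _ _ _

theorem relIndex_dvd_index_of_isSubnormal [Finite G] (S : Subgroup G) {H : Subgroup G}
    (hH : H.IsSubnormal) : S.relIndex H ∣ S.index := by
  induction hH with
  | top => rw [relIndex_top_right]
  | step H K hHK _ hN ih =>
    refine Dvd.dvd.trans ?_ ih
    have := relIndex_dvd_index_of_normal_right (S.subgroupOf K) (H.subgroupOf K)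
    rwa [relIndex_subgroupOf hHK] at this

theorem le_sylow_of_isSubnormal [Finite G] [Fact p.Prime] {H : Subgroup G} (hH : H.IsSubnormal)
    (hp : IsPGroup p H) (S : Sylow p G) : H ≤ S := by
  obtain ⟨n, hn⟩ := hp.index ((S : Subgroup G).subgroupOf H)
  rcases n with _ | n
  · exact relIndex_eq_one.mp (by simpa using hn)
  · exact absurd ((dvd_pow_self p n.succ_ne_zero).trans
      (hn ▸ relIndex_dvd_index_of_isSubnormal (S : Subgroup G) hH)) S.not_dvd_index

theorem exists_normal_isPGroup_of_isSubnormal [Finite G] [Fact p.Prime] {H : Subgroup G}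
    (hH : H.IsSubnormal) (hp : IsPGroup p H) :
    ∃ N : Subgroup G, N.Normal ∧ IsPGroup p N ∧ H ≤ N := by
  obtain ⟨S⟩ : Nonempty (Sylow p G) := inferInstance
  refine ⟨(S : Subgroup G).normalCore, inferInstance, S.isPGroup'.to_le (normalCore_le _),
    fun h hh g => ?_⟩
  have hg : h ∈ ((g⁻¹ • S : Sylow p G) : Set G) := le_sylow_of_isSubnormal hH hp (g⁻¹ • S) hh
  rwa [Sylow.coe_smul, Set.mem_smul_set_iff_inv_smul_mem, ← map_inv, inv_inv] at hg

/-- `g` normalizes some `p`-subgroup containing `x`. For a `p`-element `x` of a finite group this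
means that `⟨x⟩` is subnormal in `⟨x, g⟩`. -/
def NormalizesPSubgroup (p : ℕ) (x g : G) : Prop :=
  ∃ N : Subgroup G, IsPGroup p N ∧ x ∈ N ∧ g ∈ normalizer (N : Set G)

theorem isSubnormal_iff_normalizesPSubgroup [Finite G] [Fact p.Prime] {x : G}
    (hx : IsPGroup p (zpowers x)) (g : G) :
    ((zpowers x).subgroupOf (closure {x, g})).IsSubnormal ↔ NormalizesPSubgroup p x g := by
  set L := closure {x, g}
  have hxL : x ∈ L := subset_closure (by simp)
  have hgL : g ∈ L := subset_closure (by simp)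
  constructor
  · intro h
    obtain ⟨N, hN, hNp, hxN⟩ := exists_normal_isPGroup_of_isSubnormal h
      (hx.comap_of_injective L.subtype L.subtype_injective)
    refine ⟨N.map L.subtype, hNp.map _, ⟨⟨x, hxL⟩, hxN (mem_subgroupOf.mpr (mem_zpowers x)), rfl⟩,
      le_normalizer_map _ ⟨⟨g, hgL⟩, ?_, rfl⟩⟩
    rw [normalizer_eq_top]
    exact mem_top _
  · rintro ⟨N, hN, hxN, hg⟩
    have hLN : L ≤ normalizer (N : Set G) := by
      rw [closure_le]
      rintro y (rfl | rfl)
      exacts [le_normalizer hxN, hg]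
    have : Group.IsNilpotent (N.subgroupOf L) :=
      (hN.comap_of_injective L.subtype L.subtype_injective).isNilpotent
    exact IsSubnormal.trans (K := N.subgroupOf L)
      (fun y hy => (zpowers_le.mpr hxN : zpowers x ≤ N) hy) (isSubnormal_of_isNilpotent _)
      (normal_subgroupOf_of_le_normalizer hLN).isSubnormal

theorem subnormalizer_eq_closure [Finite G] [Fact p.Prime] {x : G} (hx : IsPGroup p (zpowers x)) :
    subnormalizer x = closure {g | NormalizesPSubgroup p x g} := by
  simp only [subnormalizer, isSubnormal_iff_normalizesPSubgroup hx]

theorem subnormalizer_le_iff [Finite G] [Fact p.Prime] {x : G} (hx : IsPGroup p (zpowers x))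
    {K : Subgroup G} :
    subnormalizer x ≤ K ↔ ∀ g, NormalizesPSubgroup p x g → g ∈ K := by
  rw [subnormalizer_eq_closure hx, closure_le]
  rfl

theorem subnormalizer_one [Finite G] : subnormalizer (1 : G) = ⊤ := by
  refine top_le_iff.mp fun g _ => subset_closure ?_
  have : ((zpowers (1 : G)).subgroupOf (closure {1, g})) = ⊥ := by simp
  simp only [Set.mem_ofPred_eq, this, IsSubnormal.bot]

theorem self_mem_subnormalizer (x : G) : x ∈ subnormalizer x := by
  refine subset_closure ?_
  have : (zpowers x).subgroupOf (closure {x, x}) = ⊤ := by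
    rw [subgroupOf_eq_top, Set.pair_eq_singleton, zpowers_eq_closure]
  simp only [Set.mem_ofPred_eq, this, IsSubnormal.top]

namespace NormalizesPSubgroup

variable {G' : Type*} [Group G'] {x g : G}

theorem mem_subnormalizer [Finite G] [Fact p.Prime] (h : NormalizesPSubgroup p x g) :
    g ∈ subnormalizer x := by
  obtain ⟨N, hN, hxN, hg⟩ := h
  rw [subnormalizer_eq_closure (hN.to_le (zpowers_le.mpr hxN))]
  exact subset_closure ⟨N, hN, hxN, hg⟩

theorem map (φ : G →* G') (h : NormalizesPSubgroup p x g) :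
    NormalizesPSubgroup p (φ x) (φ g) := by
  obtain ⟨N, hN, hxN, hg⟩ := h
  exact ⟨N.map φ, hN.map φ, mem_map_of_mem φ hxN, le_normalizer_map φ (mem_map_of_mem φ hg)⟩

theorem comap {φ : G →* G'} (hφ : Function.Injective φ)
    (h : NormalizesPSubgroup p (φ x) (φ g)) : NormalizesPSubgroup p x g := by
  obtain ⟨N, hN, hxN, hg⟩ := h
  exact ⟨N.comap φ, hN.comap_of_injective φ hφ, hxN, le_normalizer_comap φ hg⟩

/-- If `N` is a `p`-subgroup normalized by `g` but not inside `E`, then `N` being nilpotent, some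
`n ∈ N \ E` normalizes `N ⊓ E`, which `hE` forbids. -/
theorem mem_of_normalizer_le [Finite G] [Fact p.Prime] {E : Subgroup G} (hxE : x ∈ E)
    (hE : ∀ M ≤ E, x ∈ M → normalizer (M : Set G) ≤ E) (h : NormalizesPSubgroup p x g) :
    g ∈ E := by
  obtain ⟨N, hN, hxN, hg⟩ := h
  have := hN.isNilpotent
  refine hE N ?_ hxN hg
  by_contra hNE
  obtain ⟨n, hn, hnE⟩ := SetLike.exists_of_lt <|
    Group.normalizerCondition_of_isNilpotent (G := N) (E.subgroupOf N)
      (lt_top_iff_ne_top.mpr (by rwa [Ne, subgroupOf_eq_top]))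
  refine hnE (mem_subgroupOf.mpr (hE (N ⊓ E) inf_le_right ⟨hxN, hxE⟩ ?_))
  have := le_normalizer_map N.subtype (mem_map_of_mem N.subtype hn)
  rwa [subgroupOf_map_subtype, inf_comm] at this

end NormalizesPSubgroup

theorem le_subnormalizer_of_isPGroup [Finite G] [Fact p.Prime] {x : G} {N : Subgroup G}
    (hN : IsPGroup p N) (hx : x ∈ N) : N ≤ subnormalizer x :=
  fun _ hg => NormalizesPSubgroup.mem_subnormalizer ⟨N, hN, hx, le_normalizer hg⟩

end Criterion

section Cycles

variable {α : Type*} {x : Equiv.Perm α} {X : Set α}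

theorem zpow_apply_eq_self_iff (x : Equiv.Perm α) (a : α) (i : ℤ) :
    (x ^ i) a = a ↔ (Function.minimalPeriod x a : ℤ) ∣ i :=
  MulAction.zpow_smul_eq_iff_minimalPeriod_dvd (a := x) (b := a)

theorem minimalPeriod_eq_prime_pow {p : ℕ} [Fact p.Prime] {a : α} {j : ℕ}
    (h0 : (x ^ p ^ j) a ≠ a) (h1 : (x ^ p ^ (j + 1)) a = a) :
    Function.minimalPeriod x a = p ^ (j + 1) := by
  rw [← Equiv.Perm.iterate_eq_pow] at h0 h1
  exact Function.minimalPeriod_eq_prime_pow h0 h1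

theorem ncard_sameCycle (x : Equiv.Perm α) (a : α) :
    {b | x.SameCycle a b}.ncard = Function.minimalPeriod x a := by
  have h : {b | x.SameCycle a b} = MulAction.orbit (zpowers x) a := by
    ext b
    exact ⟨fun ⟨i, hi⟩ => ⟨⟨x ^ i, i, rfl⟩, hi⟩, fun ⟨⟨_, i, rfl⟩, hi⟩ => ⟨i, hi⟩⟩
  rw [h, ← Nat.card_coe_set_eq, Nat.card_congr (MulAction.orbitZPowersEquiv x a), Nat.card_zmod]
  rfl

theorem minimalPeriod_eq_of_sameCycle {a b : α} (h : x.SameCycle a b) :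
    Function.minimalPeriod x a = Function.minimalPeriod x b := by
  rw [← ncard_sameCycle, ← ncard_sameCycle]
  congr 1
  ext c
  exact ⟨h.symm.trans, h.trans⟩

theorem smul_setOf_sameCycle (x : Equiv.Perm α) (a : α) :
    x • {b | x.SameCycle a b} = {b | x.SameCycle a b} :=
  MulAction.mem_stabilizer_set.mpr fun _ => Equiv.Perm.sameCycle_apply_right

theorem setOf_sameCycle_subset (hX : x • X = X) {a : α} (ha : a ∈ X) :
    {b | x.SameCycle a b} ⊆ X := by
  rintro _ ⟨i, rfl⟩
  exact (MulAction.mem_stabilizer_set.mp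
    (zpow_mem (K := MulAction.stabilizer (Equiv.Perm α) X) hX i) a).mpr ha

end Cycles

section CyclePermutation

variable {α : Type*} {p : ℕ}

theorem sameCycle_apply_apply_iff_of_commute {g t : Equiv.Perm α} (h : Commute g t) {a b : α} :
    t.SameCycle (g a) (g b) ↔ t.SameCycle a b := by
  conv_lhs => rw [← mul_inv_eq_iff_eq_mul.mpr h.eq]
  simp [Equiv.Perm.sameCycle_conj]

/-- The action of the centralizer of `t` on the set of cycles of `t`. -/
def cyclePerm (t : Equiv.Perm α) :
    centralizer {t} →* Equiv.Perm (Quotient (Equiv.Perm.SameCycle.setoid t)) where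
  toFun g := Quotient.congr g.1 fun _ _ =>
    (sameCycle_apply_apply_iff_of_commute (mem_centralizer_singleton_iff.mp g.2)).symm
  map_one' := by ext q; induction q using Quotient.inductionOn; rfl
  map_mul' _ _ := by ext q; induction q using Quotient.inductionOn; rfl

theorem mem_ker_cyclePerm {t : Equiv.Perm α} {g : centralizer {t}} :
    g ∈ (cyclePerm t).ker ↔ ∀ a, t.SameCycle (g.1 a) a := by
  rw [MonoidHom.mem_ker, Equiv.ext_iff, Quotient.mk_surjective.forall]
  exact forall_congr' fun a => Quotient.eq

theorem pow_eq_one_of_mem_ker_cyclePerm {t : Equiv.Perm α} {n : ℕ} (ht : t ^ n = 1)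
    {g : centralizer {t}} (hg : g ∈ (cyclePerm t).ker) : g ^ n = 1 := by
  have hcomm : Commute g.1 t := mem_centralizer_singleton_iff.mp g.2
  refine Subtype.ext (Equiv.ext fun a => ?_)
  obtain ⟨i, hi⟩ := mem_ker_cyclePerm.mp hg a
  have hfix : ((t ^ i * g.1) ^ n) a = a := Equiv.Perm.pow_apply_eq_self_of_apply_eq_self hi n
  rwa [(hcomm.zpow_right i).symm.mul_pow, ← zpow_natCast (t ^ i), zpow_comm, zpow_natCast, ht,
    one_zpow, one_mul] at hfix

theorem isPGroup_comap_cyclePerm {t : Equiv.Perm α} {n : ℕ} (ht : t ^ p ^ n = 1)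
    {Q : Subgroup (Equiv.Perm (Quotient (Equiv.Perm.SameCycle.setoid t)))} (hQ : IsPGroup p Q) :
    IsPGroup p (Q.comap (cyclePerm t)) :=
  hQ.comap_of_ker_isPGroup _ fun g => ⟨n, Subtype.ext (pow_eq_one_of_mem_ker_cyclePerm ht g.2)⟩

/-- The preimage under `cyclePerm t` of the group generated by the image of `x` is a `p`-group, and
it contains the kernel of `cyclePerm t`. -/
theorem mem_subnormalizer_of_commute_of_sameCycle [Finite α] [Fact p.Prime]
    {t x g : Equiv.Perm α} {n : ℕ} (hx : IsPGroup p (zpowers x)) (ht : t ^ p ^ n = 1)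
    (hxt : Commute x t) (hgt : Commute g t) (hg : ∀ a, t.SameCycle (g a) a) :
    g ∈ subnormalizer x := by
  let x' : centralizer {t} := ⟨x, mem_centralizer_singleton_iff.mpr hxt⟩
  let g' : centralizer {t} := ⟨g, mem_centralizer_singleton_iff.mpr hgt⟩
  have hx' : IsPGroup p (zpowers x') :=
    (hx.comap_of_injective _ (centralizer {t}).subtype_injective).to_le
      (zpowers_le.mpr (mem_zpowers x))
  have hQ : IsPGroup p (zpowers (cyclePerm t x')) := by
    rw [← MonoidHom.map_zpowers]
    exact hx'.map _
  have hN := isPGroup_comap_cyclePerm ht hQ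
  refine le_subnormalizer_of_isPGroup (hN.map (centralizer {t}).subtype)
    ⟨x', mem_zpowers _, rfl⟩ ⟨g', ?_, rfl⟩
  have hker : cyclePerm t g' = 1 := MonoidHom.mem_ker.mp (mem_ker_cyclePerm.mpr hg)
  rw [SetLike.mem_coe, mem_comap, hker]
  exact one_mem _

theorem swap_apply_mem_subnormalizer [Finite α] [DecidableEq α] {t x : Equiv.Perm α}
    (hx : IsPGroup 2 (zpowers x)) (ht : t * t = 1) (hxt : Commute x t) (a : α) :
    Equiv.swap a (t a) ∈ subnormalizer x := by
  have htt : t (t a) = a := DFunLike.congr_fun ht a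
  refine mem_subnormalizer_of_commute_of_sameCycle (n := 1) hx (by rwa [pow_one, pow_two]) hxt ?_
    fun b => ?_
  · rw [Commute, SemiconjBy, Equiv.mul_swap_eq_swap_mul, htt, Equiv.swap_comm]
  · rcases eq_or_ne b a with rfl | hb
    · rw [Equiv.swap_apply_left, Equiv.Perm.sameCycle_apply_left]
    · rcases eq_or_ne b (t a) with rfl | hb'
      · rw [Equiv.swap_apply_right, Equiv.Perm.sameCycle_apply_right]
      · rw [Equiv.swap_apply_of_ne_of_ne hb hb']

end CyclePermutation

section FullCycle

theorem mem_zpowers_of_commute_of_sameCycle {α : Type*} {z h : Equiv.Perm α}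
    (hz : ∀ a b, z.SameCycle a b) (hh : Commute h z) : h ∈ zpowers z := by
  rcases isEmpty_or_nonempty α with _ | ⟨⟨a⟩⟩
  · rw [Subsingleton.elim h 1]; exact one_mem _
  obtain ⟨i, hi⟩ := hz a (h a)
  refine ⟨i, Equiv.ext fun b => ?_⟩
  obtain ⟨j, rfl⟩ := hz a b
  calc (z ^ i) ((z ^ j) a) = (z ^ j) ((z ^ i) a) :=
        DFunLike.congr_fun ((Commute.refl z).zpow_zpow i j).eq a
    _ = h ((z ^ j) a) := by rw [hi]; exact (DFunLike.congr_fun (hh.zpow_right j).eq a).symm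

theorem eq_of_orderOf_eq_two {C : Type*} [Group C] [Finite C] [IsCyclic C] {s t : C}
    (hs : orderOf s = 2) (ht : orderOf t = 2) : s = t := by
  classical
  have := Fintype.ofFinite C
  have hcard := IsCyclic.card_orderOf_eq_totient (α := C) (d := 2)
    (by rw [← hs]; exact orderOf_dvd_card)
  exact Finset.card_le_one.mp hcard.le s (by simpa using hs) t (by simpa using ht)

/-- If `M` centralizes the involution `t` of `⟨z⟩` and `n` normalizes `M`, then `n * t * n⁻¹`
commutes with `z`, so that it is an involution of the group `⟨z⟩`, which is its own centralizer. -/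
theorem mem_centralizer_of_normalizesPSubgroup {α : Type*} [Finite α] {z g : Equiv.Perm α}
    (hz : ∀ a b, z.SameCycle a b) {m : ℕ} (ht : orderOf (z ^ m) = 2)
    (hg : NormalizesPSubgroup 2 z g) : g ∈ centralizer {z ^ m} := by
  refine hg.mem_of_normalizer_le (mem_centralizer_singleton_iff.mpr
    (Commute.self_pow z m)) fun M hM hzM n hn => ?_
  have hcomm : Commute (n * z ^ m * n⁻¹) z := by
    have hzn : n⁻¹ * z * n ∈ M := (mem_normalizer_iff''.mp hn z).mp hzM
    have := (mem_centralizer_singleton_iff.mp (hM hzn)).symm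
    simpa [mul_assoc] using Commute.map this (MulAut.conj n)
  have hconj : n * z ^ m * n⁻¹ = z ^ m := by
    have hs : orderOf (n * z ^ m * n⁻¹) = 2 :=
      (orderOf_injective (MulAut.conj n).toMonoidHom (MulAut.conj n).injective _).trans ht
    exact congrArg Subtype.val <| eq_of_orderOf_eq_two (C := zpowers z)
      (s := ⟨_, mem_zpowers_of_commute_of_sameCycle hz hcomm⟩)
      (t := ⟨_, npow_mem_zpowers z m⟩) (by simpa using hs) (by simpa using ht)
  exact mem_centralizer_singleton_iff.mpr (mul_inv_eq_iff_eq_mul.mp hconj)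

/-- The subnormalizer of `z` centralizes the involution `t` of `⟨z⟩`, and the cycles of `t` are
permuted by `z` in a single, shorter cycle. -/
theorem isPGroup_subnormalizer_of_sameCycle {n : ℕ} : ∀ {α : Type*} [Finite α]
    {z : Equiv.Perm α}, (∀ a b, z.SameCycle a b) → z ^ 2 ^ n = 1 →
      IsPGroup 2 (subnormalizer z) := by
  induction n with
  | zero =>
    intro α _ z hz hz1
    have : Subsingleton α := ⟨fun a b => by
      obtain ⟨i, rfl⟩ := hz a b
      rw [show z = 1 by simpa using hz1, one_zpow, Equiv.Perm.one_apply]⟩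
    exact IsPGroup.of_subsingleton _ _
  | succ n ih =>
    intro α _ z hz hz1
    by_cases ht : z ^ 2 ^ n = 1
    · exact ih hz ht
    set t := z ^ 2 ^ n with htz
    have ht2 : t ^ 2 = 1 := by rw [htz, ← pow_mul, ← pow_succ, hz1]
    let z' : centralizer {t} := ⟨z, mem_centralizer_singleton_iff.mpr (Commute.self_pow z _)⟩
    have hz' : ∀ a b, (cyclePerm t z').SameCycle a b := by
      refine Quotient.mk_surjective.forall₂.mpr fun a b => ?_
      obtain ⟨i, rfl⟩ := hz a b
      exact ⟨i, by rw [← map_zpow]; rfl⟩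
    have hpow : cyclePerm t z' ^ 2 ^ n = 1 := by
      rw [← map_pow]
      exact MonoidHom.mem_ker.mp (mem_ker_cyclePerm.mpr fun a =>
        Equiv.Perm.sameCycle_apply_left.mpr (Equiv.Perm.SameCycle.refl t a))
    have hN := isPGroup_comap_cyclePerm (p := 2) (n := 1) (by simpa using ht2) (ih hz' hpow)
    refine (hN.map (centralizer {t}).subtype).to_le ?_
    refine (subnormalizer_le_iff (isPGroup_zpowers_of_pow_eq_one hz1)).mpr fun g hg => ?_
    have hgt := mem_centralizer_of_normalizesPSubgroup hz (orderOf_eq_prime ht2 ht) hg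
    have hg' : NormalizesPSubgroup 2 z' ⟨g, hgt⟩ :=
      .comap (centralizer {t}).subtype_injective hg
    exact ⟨⟨g, hgt⟩, (hg'.map (cyclePerm t)).mem_subnormalizer, rfl⟩

end FullCycle

section Interchange

variable {α : Type*}

theorem exists_involution_of_equiv {X Y : Set α} (hXY : Disjoint X Y) (e : X ≃ Y) :
    ∃ t : Equiv.Perm α, t * t = 1 ∧ (∀ a : X, t a = e a) ∧ (∀ b : Y, t b = e.symm b) ∧
      ∀ c ∉ X ∪ Y, t c = c := by
  classical
  let s : Equiv.Perm (X ⊕ Y) := (Equiv.sumCongr e e.symm).trans (Equiv.sumComm Y X)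
  let f : X ⊕ Y ≃ {c // c ∈ X ∪ Y} := (Equiv.Set.union hXY).symm
  have hX (a : X) : (s.extendDomain f) a = e a := by
    simpa [s, f] using s.extendDomain_apply_image f (Sum.inl a)
  have hY (b : Y) : (s.extendDomain f) b = e.symm b := by
    simpa [s, f] using s.extendDomain_apply_image f (Sum.inr b)
  refine ⟨s.extendDomain f, ?_, hX, hY, fun c hc => s.extendDomain_apply_not_subtype f hc⟩
  rw [Equiv.Perm.extendDomain_mul]
  convert Equiv.Perm.extendDomain_one f
  ext (c | c) <;> simp [s]

theorem exists_smul_eq_and_smul_eq_of_ncard_eq [Finite α] {X Y : Set α} (h : X.ncard = Y.ncard) :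
    ∃ t : Equiv.Perm α, t • X = Y ∧ t • Y = X := by
  have hcard : (X \ Y).ncard = (Y \ X).ncard := by
    have hX := Set.ncard_inter_add_ncard_sdiff_eq_ncard X Y
    have hY := Set.ncard_inter_add_ncard_sdiff_eq_ncard Y X
    rw [Set.inter_comm] at hY
    lia
  obtain ⟨t, htt, htX, htY, ht⟩ := exists_involution_of_equiv
    (disjoint_sdiff_sdiff : Disjoint (X \ Y) (Y \ X))
    (Finite.card_eq.mp hcard).some
  have key {a : α} : t a ∈ Y ↔ a ∈ X := by
    by_cases h1 : a ∈ X \ Y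
    · simpa [htX ⟨a, h1⟩, h1.1] using (Subtype.prop (_ : (Y \ X : Set α))).1
    by_cases h2 : a ∈ Y \ X
    · simpa [htY ⟨a, h2⟩, h2.2] using (Subtype.prop (_ : (X \ Y : Set α))).2
    rw [ht a (by simp only [Set.mem_union]; tauto)]
    simp only [Set.mem_sdiff] at h1 h2
    tauto
  have hXY : t • X = Y := by
    ext a
    rw [Set.mem_smul_set_iff_inv_smul_mem, Equiv.Perm.smul_def, ← key, ← Equiv.Perm.mul_apply,
      mul_inv_cancel, Equiv.Perm.one_apply]
  exact ⟨t, hXY, by rw [← hXY, smul_smul, htt, one_smul]⟩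

theorem exists_equiv_orbit_of_stabilizer_eq {G : Type*} [Group G] [MulAction G α] {a b : α}
    (h : MulAction.stabilizer G a = MulAction.stabilizer G b) :
    ∃ e : MulAction.orbit G a ≃ MulAction.orbit G b,
      ∀ g : G, (e ⟨g • a, MulAction.mem_orbit a g⟩ : α) = g • b := by
  refine ⟨(MulAction.orbitEquivQuotientStabilizer G a).trans
    ((quotientEquivOfEq h).trans (MulAction.orbitEquivQuotientStabilizer G b).symm), fun g => ?_⟩
  have : MulAction.orbitEquivQuotientStabilizer G a ⟨g • a, MulAction.mem_orbit a g⟩ = g := by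
    rw [← Equiv.eq_symm_apply]
    exact Subtype.ext (MulAction.orbitEquivQuotientStabilizer_symm_apply G a g).symm
  simp only [Equiv.trans_apply, this]
  exact MulAction.orbitEquivQuotientStabilizer_symm_apply G b g

theorem exists_involution_of_stabilizer_eq {G : Type*} [Group G] [MulAction G α] {a b : α}
    (h : MulAction.stabilizer G a = MulAction.stabilizer G b) (hab : b ∉ MulAction.orbit G a) :
    ∃ t : Equiv.Perm α, t * t = 1 ∧ t a = b ∧ ∀ (g : G) c, t (g • c) = g • t c := by
  obtain ⟨e, he⟩ := exists_equiv_orbit_of_stabilizer_eq h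
  have hdisj : Disjoint (MulAction.orbit G a) (MulAction.orbit G b) :=
    MulAction.orbit.pairwiseDisjoint ⟨a, rfl⟩ ⟨b, rfl⟩ fun h' =>
      hab (MulAction.orbit_eq_iff.mp h'.symm)
  obtain ⟨t, htt, hta, -, ht⟩ := exists_involution_of_equiv hdisj e
  have hta (g : G) : t (g • a) = g • b := (hta ⟨_, MulAction.mem_orbit a g⟩).trans (he g)
  have htb (g : G) : t (g • b) = g • a := by
    rw [← hta, ← Equiv.Perm.mul_apply, htt, Equiv.Perm.one_apply]
  refine ⟨t, htt, by simpa using hta 1, fun g c => ?_⟩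
  by_cases hc : c ∈ MulAction.orbit G a ∪ MulAction.orbit G b
  · rcases hc with ⟨g', rfl⟩ | ⟨g', rfl⟩
    · simp only [smul_smul, hta]
    · simp only [smul_smul, htb]
  · rw [ht c hc, ht]
    simpa [← MulAction.orbit_eq_iff] using hc

theorem swap_mem_subnormalizer_of_minimalPeriod_eq [Finite α] [DecidableEq α] {x : Equiv.Perm α}
    (hx : IsPGroup 2 (zpowers x)) {a b : α} (hab : ¬ x.SameCycle a b)
    (h : Function.minimalPeriod x a = Function.minimalPeriod x b) :
    Equiv.swap a b ∈ subnormalizer x := by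
  have hstab : MulAction.stabilizer (zpowers x) a = MulAction.stabilizer (zpowers x) b := by
    ext ⟨_, i, rfl⟩
    change (x ^ i) a = a ↔ (x ^ i) b = b
    rw [zpow_apply_eq_self_iff, zpow_apply_eq_self_iff, h]
  obtain ⟨t, htt, rfl, ht⟩ := exists_involution_of_stabilizer_eq hstab
    (by rintro ⟨⟨_, i, rfl⟩, hb⟩; exact hab ⟨i, hb⟩)
  exact swap_apply_mem_subnormalizer hx htt
    (Equiv.ext fun c => (ht ⟨x, mem_zpowers x⟩ c).symm) a

end Interchange

section Exchange

variable {G : Type*} [Group G] [Finite G]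

theorem exists_mem_subnormalizer_notMem_of_dvd_relIndex {p : ℕ} [Fact p.Prime] {x : G}
    (hx : IsPGroup p (zpowers x)) {G₀ G₁ : Subgroup G} (hx₀ : x ∈ G₀)
    (hdvd : p ∣ G₁.relIndex G₀) : ∃ σ ∈ subnormalizer x, σ ∈ G₀ ∧ σ ∉ G₁ := by
  obtain ⟨S, hS⟩ := (hx.comap_of_injective G₀.subtype G₀.subtype_injective).exists_le_sylow
  have hle : (S : Subgroup G₀).map G₀.subtype ≤ subnormalizer x :=
    le_subnormalizer_of_isPGroup (S.isPGroup'.map _) ⟨⟨x, hx₀⟩, hS (mem_zpowers x), rfl⟩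
  by_contra! hcon
  have hSG₁ : (S : Subgroup G₀) ≤ G₁.subgroupOf G₀ := fun q hq => hcon q (hle ⟨q, hq, rfl⟩) q.2
  exact S.not_dvd_index (hdvd.trans (index_dvd_of_le hSG₁))

theorem exists_mem_subnormalizer_smul_eq {β : Type*} [MulAction G β] {x t : G}
    (hx : IsPGroup 2 (zpowers x)) {Y Z : β} (hY : x • Y = Y) (hZ : x • Z = Z) (htY : t • Y = Z)
    (htZ : t • Z = Y) : ∃ σ ∈ subnormalizer x, σ • Y = Z := by
  by_cases hYZ : Y = Z
  · exact ⟨1, one_mem _, by rw [one_smul, hYZ]⟩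
  have hpair {g : G} : g ∈ MulAction.stabilizer G ({Y, Z} : Set β) ↔
      g • Y = Y ∧ g • Z = Z ∨ g • Y = Z ∧ g • Z = Y := by
    rw [MulAction.mem_stabilizer_iff, Set.smul_set_insert, Set.smul_set_singleton,
      Set.pair_eq_pair_iff]
  have hindex : (MulAction.stabilizer G Y).relIndex
      (MulAction.stabilizer G ({Y, Z} : Set β)) = 2 := by
    refine relIndex_eq_two_iff.mpr ⟨t, hpair.mpr (Or.inr ⟨htY, htZ⟩), fun b hb => ?_⟩
    rcases hpair.mp hb with ⟨hbY, hbZ⟩ | ⟨hbY, hbZ⟩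
    · exact Or.inr ⟨hbY, fun h => hYZ (by rw [← hbZ, ← htY, smul_smul]; exact h.symm)⟩
    · exact Or.inl ⟨by rw [MulAction.mem_stabilizer_iff, mul_smul, htY, hbZ],
        fun h => hYZ (h.symm.trans hbY)⟩
  obtain ⟨σ, hσ, hσ₀, hσ₁⟩ := exists_mem_subnormalizer_notMem_of_dvd_relIndex hx
    (hpair.mpr (Or.inl ⟨hY, hZ⟩)) hindex.symm.dvd
  exact ⟨σ, hσ, ((hpair.mp hσ₀).resolve_left fun h => hσ₁ h.1).1⟩

theorem exists_mem_subnormalizer_smul_eq_of_ncard_eq {α : Type*} [Finite α] {x : Equiv.Perm α}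
    (hx : IsPGroup 2 (zpowers x)) {Y Z : Set α} (hY : x • Y = Y) (hZ : x • Z = Z)
    (h : Y.ncard = Z.ncard) : ∃ σ ∈ subnormalizer x, σ • Y = Z := by
  obtain ⟨t, htY, htZ⟩ := exists_smul_eq_and_smul_eq_of_ncard_eq h
  exact exists_mem_subnormalizer_smul_eq hx hY hZ htY htZ

end Exchange

section ContainsSwaps

variable {α : Type*} [DecidableEq α]

/-- `K` contains all transpositions of points of `X`, and hence the symmetric group on `X` if `X`
is finite. -/
def ContainsSwaps (K : Subgroup (Equiv.Perm α)) (X : Set α) : Prop :=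
  ∀ a ∈ X, ∀ b ∈ X, Equiv.swap a b ∈ K

namespace ContainsSwaps

variable {K : Subgroup (Equiv.Perm α)} {X Y : Set α}

theorem eq_top [Finite α] (h : ContainsSwaps K Set.univ) : K = ⊤ := by
  rw [eq_top_iff, ← Equiv.Perm.closure_isSwap, closure_le]
  rintro _ ⟨a, b, -, rfl⟩
  exact h a (Set.mem_univ a) b (Set.mem_univ b)

theorem smul (h : ContainsSwaps K X) {σ : Equiv.Perm α} (hσ : σ ∈ K) :
    ContainsSwaps K (σ • X) := by
  rintro _ ⟨a, ha, rfl⟩ _ ⟨b, hb, rfl⟩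
  change Equiv.swap (σ a) (σ b) ∈ K
  rw [Equiv.swap_apply_apply]
  exact mul_mem (mul_mem hσ (h a ha b hb)) (inv_mem hσ)

theorem union_of_swap_mem (hX : ContainsSwaps K X) (hY : ContainsSwaps K Y) {a b : α}
    (ha : a ∈ X) (hb : b ∈ Y) (hab : Equiv.swap a b ∈ K) : ContainsSwaps K (X ∪ Y) := by
  have hswap {c d : α} (hc : c ∈ X) (hd : d ∈ Y) : Equiv.swap c d ∈ K :=
    SubmonoidClass.swap_mem_trans K (hX c hc a ha)
      (SubmonoidClass.swap_mem_trans K hab (hY b hb d hd))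
  rintro c (hc | hc) d (hd | hd)
  exacts [hX c hc d hd, hswap hc hd, Equiv.swap_comm d c ▸ hswap hd hc, hY c hc d hd]

theorem union (hX : ContainsSwaps K X) (hY : ContainsSwaps K Y) (hXY : (X ∩ Y).Nonempty) :
    ContainsSwaps K (X ∪ Y) := by
  obtain ⟨a, haX, haY⟩ := hXY
  exact hX.union_of_swap_mem hY haX haY (hX a haX a haX)

end ContainsSwaps

end ContainsSwaps

section Restriction

variable {p : ℕ}

theorem isPGroup_prod {A B : Type*} [Group A] [Group B] (hA : IsPGroup p A) (hB : IsPGroup p B) :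
    IsPGroup p (A × B) := by
  rintro ⟨a, b⟩
  obtain ⟨i, hi⟩ := hA a
  obtain ⟨j, hj⟩ := hB b
  refine ⟨i + j, Prod.ext ?_ ?_⟩
  · rw [Prod.pow_fst, pow_add, pow_mul, hi, one_pow, Prod.fst_one]
  · rw [Prod.pow_snd, add_comm, pow_add, pow_mul, hj, one_pow, Prod.snd_one]

theorem NormalizesPSubgroup.map_prod {A B G : Type*} [Group A] [Group B] [Group G]
    (ψ : A × B →* G) {y g : A} {z : B} (hz : IsPGroup p (zpowers z))
    (h : NormalizesPSubgroup p y g) : NormalizesPSubgroup p (ψ (y, z)) (ψ (g, 1)) := by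
  obtain ⟨N, hN, hy, hg⟩ := h
  refine NormalizesPSubgroup.map ψ ⟨N.prod (zpowers z),
    (isPGroup_prod hN hz).of_equiv (prodEquiv N (zpowers z)).symm, ⟨hy, mem_zpowers z⟩, ?_⟩
  rw [mem_normalizer_iff] at hg ⊢
  rintro ⟨a, b⟩
  simp only [mem_prod, Prod.fst_mul, Prod.snd_mul, Prod.fst_inv, Prod.snd_inv, hg a, one_mul,
    inv_one, mul_one]

variable {α : Type*} {P : α → Prop} {x : Equiv.Perm α}

theorem subtypePerm_pow_eq_one (hP : ∀ a, P (x a) ↔ P a) {n : ℕ} (h : ∀ a, P a → (x ^ n) a = a) :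
    x.subtypePerm hP ^ n = 1 := by
  rw [Equiv.Perm.subtypePerm_pow]
  ext a
  exact h a a.2

theorem isPGroup_zpowers_subtypePerm (hP : ∀ a, P (x a) ↔ P a) (hx : IsPGroup p (zpowers x)) :
    IsPGroup p (zpowers (x.subtypePerm hP)) := by
  obtain ⟨n, hn⟩ := hx ⟨x, mem_zpowers x⟩
  have hn : x ^ p ^ n = 1 := congrArg Subtype.val hn
  refine isPGroup_zpowers_of_pow_eq_one (n := n) (subtypePerm_pow_eq_one hP fun a _ => ?_)
  rw [hn, Equiv.Perm.one_apply]

theorem ofSubtype_mem_subnormalizer [Finite α] [DecidablePred P] [Fact p.Prime]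
    (hP : ∀ a, P (x a) ↔ P a) (hx : IsPGroup p (zpowers x)) {g : Equiv.Perm {a // P a}}
    (hg : g ∈ subnormalizer (x.subtypePerm hP)) :
    Equiv.Perm.ofSubtype g ∈ subnormalizer x := by
  have hP' : ∀ a, ¬ P (x a) ↔ ¬ P a := fun a => not_congr (hP a)
  have hxP : Equiv.Perm.subtypeCongrHom P (x.subtypePerm hP, x.subtypePerm hP') = x := by
    ext a
    by_cases ha : P a <;> simp [ha]
  suffices h : subnormalizer (x.subtypePerm hP) ≤ (subnormalizer x).comap
      (Equiv.Perm.ofSubtype : Equiv.Perm {a // P a} →* Equiv.Perm α) from h hg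
  refine (subnormalizer_le_iff (isPGroup_zpowers_subtypePerm hP hx)).mpr fun g hg => ?_
  have hgP : Equiv.Perm.subtypeCongrHom P (g, 1) = Equiv.Perm.ofSubtype g := by
    ext a
    by_cases ha : P a
    · simp [ha, Equiv.Perm.ofSubtype_apply_of_mem]
    · simp [ha, Equiv.Perm.ofSubtype_apply_of_not_mem]
  have := hg.map_prod (Equiv.Perm.subtypeCongrHom P) (isPGroup_zpowers_subtypePerm hP' hx)
  rw [hxP, hgP] at this
  exact this.mem_subnormalizer

theorem containsSwaps_of_subnormalizer_subtypePerm_eq_top [Finite α] [DecidableEq α]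
    [Fact p.Prime] {X : Set α} (hX : ∀ a, x a ∈ X ↔ a ∈ X) (hx : IsPGroup p (zpowers x))
    (h : subnormalizer (x.subtypePerm hX) = ⊤) : ContainsSwaps (subnormalizer x) X := by
  classical
  intro a ha b hb
  have := ofSubtype_mem_subnormalizer hX hx (g := Equiv.swap ⟨a, ha⟩ ⟨b, hb⟩) (h ▸ mem_top _)
  rwa [Equiv.Perm.ofSubtype_swap_eq] at this

end Restriction

section InvariantSubsets

variable {α : Type*} {x : Equiv.Perm α} {X : Set α}

/-- Collect whole cycles of length `p ^ (j + 1)` until none is left. -/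
theorem exists_subset_smul_eq_self_ncard_eq [Finite α] {p : ℕ} [Fact p.Prime] (j : ℕ) :
    ∀ (m : ℕ) {X : Set α}, x • X = X → (∀ a ∈ X, (x ^ p ^ j) a = a) → m * p ^ j ≤ X.ncard →
      ∃ Y ⊆ X, x • Y = Y ∧ Y.ncard = m * p ^ j := by
  induction j with
  | zero =>
    intro m X _ hfix hm
    obtain ⟨Y, hYX, hY⟩ := Set.exists_subset_card_eq hm
    refine ⟨Y, hYX, ?_, hY⟩
    calc x • Y = id '' Y := Set.image_congr fun a ha => by simpa using hfix a (hYX ha)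
      _ = Y := Set.image_id Y
  | succ j ihj =>
    intro m
    induction m with
    | zero => exact fun _ _ _ => ⟨∅, Set.empty_subset _, Set.smul_set_empty, by simp⟩
    | succ m ihm =>
      intro X hX hfix hm
      by_cases hshort : ∀ a ∈ X, (x ^ p ^ j) a = a
      · rw [pow_succ', ← mul_assoc] at hm ⊢
        exact ihj _ hX hshort hm
      push Not at hshort
      obtain ⟨a, ha, hane⟩ := hshort
      set D := {b | x.SameCycle a b}
      have hDX : D ⊆ X := setOf_sameCycle_subset hX ha
      have hDcard : D.ncard = p ^ (j + 1) := by
        rw [ncard_sameCycle, minimalPeriod_eq_prime_pow hane (hfix a ha)]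
      have hDinv : x • D = D := smul_setOf_sameCycle x a
      have hdiff := Set.ncard_sdiff hDX
      obtain ⟨Y, hYX, hY, hYcard⟩ := ihm (X := X \ D) (by rw [Set.smul_set_sdiff, hX, hDinv])
        (fun b hb => hfix b hb.1) (by rw [hdiff, hDcard]; rw [add_one_mul] at hm; lia)
      refine ⟨Y ∪ D, Set.union_subset (hYX.trans Set.sdiff_subset) hDX,
        by rw [Set.smul_set_union, hY, hDinv], ?_⟩
      rw [Set.ncard_union_eq (Set.disjoint_left.mpr fun b hb => (hYX hb).2), hYcard, hDcard,
        add_one_mul]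

theorem sameCycle_sq_zpow_apply_iff (hx : IsPGroup 2 (zpowers x)) {a : α} (ha : x a ≠ a)
    {i : ℤ} : (x ^ 2).SameCycle a ((x ^ i) a) ↔ Even i := by
  have heven {j : ℤ} (hj : (x ^ j) a = a) : Even j := by
    obtain ⟨n, hn⟩ := hx ⟨x, mem_zpowers x⟩
    have hn : x ^ 2 ^ n = 1 := congrArg Subtype.val hn
    have hdvd : (Function.minimalPeriod x a : ℤ) ∣ 2 ^ n := by
      rw [← Nat.cast_two, ← Nat.cast_pow, ← zpow_apply_eq_self_iff, zpow_natCast, hn,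
        Equiv.Perm.one_apply]
    by_contra hodd
    have hcop : IsCoprime j (2 ^ n) :=
      (Int.isCoprime_two_right.mpr (Int.not_even_iff_odd.mp hodd)).pow_right
    have hunit := hcop.isUnit_of_dvd' ((zpow_apply_eq_self_iff x a j).mp hj) hdvd
    exact ha (Function.minimalPeriod_eq_one_iff_isFixedPt.mp
      (Nat.isUnit_iff.mp (Int.ofNat_isUnit.mp hunit)))
  constructor
  · rintro ⟨j, hj⟩
    have h : (x ^ (2 * j - i)) a = a := by
      rw [sub_eq_neg_add, zpow_add, Equiv.Perm.mul_apply, zpow_neg, Equiv.Perm.inv_eq_iff_eq,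
        zpow_mul]
      exact hj
    simpa [Int.even_sub] using heven h
  · rintro ⟨j, rfl⟩
    exact ⟨j, by rw [← two_mul, zpow_mul]; rfl⟩

theorem exists_smul_eq_compl (hx : IsPGroup 2 (zpowers x)) (hfix : ∀ a, x a ≠ a) :
    ∃ C : Set α, x • C = Cᶜ := by
  let s := Equiv.Perm.SameCycle.setoid x
  -- Colour each cycle alternately; all cycles have even length.
  refine ⟨{a | (x ^ 2).SameCycle (Quotient.mk s a).out a}, ?_⟩
  ext b
  obtain ⟨a, rfl⟩ := x.surjective b
  have hmk : Quotient.mk s (x a) = Quotient.mk s a :=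
    Quotient.sound (Equiv.Perm.sameCycle_apply_left.mpr (Equiv.Perm.SameCycle.refl x a))
  obtain ⟨i, hi⟩ : x.SameCycle (Quotient.mk s a).out a := Quotient.mk_out (s := s) a
  have ha := sameCycle_sq_zpow_apply_iff hx (hfix (Quotient.mk s a).out) (i := i)
  have hxa := sameCycle_sq_zpow_apply_iff hx (hfix (Quotient.mk s a).out) (i := 1 + i)
  rw [hi] at ha
  rw [zpow_add, Equiv.Perm.mul_apply, hi, zpow_one, add_comm, Int.even_add_one, ← ha] at hxa
  rw [← Equiv.Perm.smul_def, Set.smul_mem_smul_set_iff, Set.mem_compl_iff, Set.mem_ofPred_eq,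
    Set.mem_ofPred_eq, Equiv.Perm.smul_def, hmk, hxa, not_not]

end InvariantSubsets

section FullSubnormalizer

variable {α : Type*} {x : Equiv.Perm α} {X Y : Set α}

theorem ContainsSwaps.eq_top_of_compl [Finite α] [DecidableEq α] {K : Subgroup (Equiv.Perm α)}
    (hX : ContainsSwaps K X) (hXc : ContainsSwaps K Xᶜ) (hY : ContainsSwaps K Y)
    (hXY : (X ∩ Y).Nonempty) (hXcY : (Xᶜ ∩ Y).Nonempty) : K = ⊤ := by
  refine ContainsSwaps.eq_top ?_
  have h := (hX.union hY hXY).union hXc (hXcY.mono fun _ ha => ⟨Or.inr ha.2, ha.1⟩)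
  rwa [Set.union_right_comm, Set.union_compl_self, Set.univ_union] at h

theorem eq_top_of_forall_swap_mem_compl [Finite α] [DecidableEq α]
    {K : Subgroup (Equiv.Perm α)} (hX : X.Nonempty) (hXc : Xᶜ.Nonempty)
    (h : ∀ a ∈ X, ∀ b ∈ Xᶜ, Equiv.swap a b ∈ K) : K = ⊤ := by
  obtain ⟨a, ha⟩ := hX
  obtain ⟨b, hb⟩ := hXc
  have h' {c d : α} (hc : c ∈ X) (hd : d ∈ Xᶜ) : Equiv.swap d c ∈ K :=
    Equiv.swap_comm c d ▸ h c hc d hd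
  have hswapsX : ContainsSwaps K X := fun c hc d hd =>
    SubmonoidClass.swap_mem_trans K (h c hc b hb) (h' hd hb)
  have hswapsXc : ContainsSwaps K Xᶜ := fun c hc d hd =>
    SubmonoidClass.swap_mem_trans K (h' ha hc) (h a ha d hd)
  refine ContainsSwaps.eq_top ?_
  rw [← Set.union_compl_self X]
  exact hswapsX.union_of_swap_mem hswapsXc ha hb (h a ha b hb)

theorem ncard_compl_eq_of_card_eq_two_mul [Finite α] {m : ℕ} (hα : Nat.card α = 2 * m)
    (hX : X.ncard = m) : Xᶜ.ncard = m := by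
  have := Set.ncard_add_ncard_compl X
  lia

theorem exists_mem_subnormalizer_smul_eq_or_eq [Finite α] (hx : IsPGroup 2 (zpowers x)) {m : ℕ}
    (hα : Nat.card α = 2 * m) (hX : x • X = X) (hXm : X.ncard = m) (hY : x • Y = Yᶜ) :
    ∃ σ ∈ subnormalizer x, σ • X = Y ∨ σ • X = Yᶜ := by
  have hYm : Y.ncard = m := by
    have hcompl : Yᶜ.ncard = Y.ncard := hY ▸ Set.ncard_smul_set x Y
    have := Set.ncard_add_ncard_compl Y
    lia
  obtain ⟨t, htX, htY⟩ := exists_smul_eq_and_smul_eq_of_ncard_eq (hXm.trans hYm.symm)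
  have hpair (g : Equiv.Perm α) (Z : Set α) : g • ({Z, Zᶜ} : Set (Set α)) = {g • Z, (g • Z)ᶜ} := by
    rw [Set.smul_set_insert, Set.smul_set_singleton, Set.smul_set_compl]
  obtain ⟨σ, hσ, h⟩ := exists_mem_subnormalizer_smul_eq hx (Y := ({X, Xᶜ} : Set (Set α)))
    (Z := {Y, Yᶜ}) (by rw [hpair, hX]) (by rw [hpair, hY, compl_compl, Set.pair_comm])
    (by rw [hpair, htX]) (by rw [hpair, htY])
  refine ⟨σ, hσ, ?_⟩
  have : σ • X ∈ σ • ({X, Xᶜ} : Set (Set α)) := Set.smul_mem_smul_set (Or.inl rfl)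
  rwa [h] at this

theorem subnormalizer_eq_top_of_forall_apply_ne [Finite α] [DecidableEq α]
    (hx : IsPGroup 2 (zpowers x)) (hfix : ∀ a, x a ≠ a) {m : ℕ} (hα : Nat.card α = 2 * m)
    (hX : x • X = X) (hXm : X.ncard = m) (hXne : X.Nonempty)
    (hswaps : ContainsSwaps (subnormalizer x) X) : subnormalizer x = ⊤ := by
  obtain ⟨C, hC⟩ := exists_smul_eq_compl hx hfix
  have hCc : x • Cᶜ = C := by rw [Set.smul_set_compl, hC, compl_compl]
  have hswapsC : ContainsSwaps (subnormalizer x) C := by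
    obtain ⟨σ, hσ, h | h⟩ := exists_mem_subnormalizer_smul_eq_or_eq hx hα hX hXm hC
    · exact h ▸ hswaps.smul hσ
    · exact hCc ▸ (h ▸ hswaps.smul hσ).smul (self_mem_subnormalizer x)
  have hswapsCc : ContainsSwaps (subnormalizer x) Cᶜ :=
    hC ▸ hswapsC.smul (self_mem_subnormalizer x)
  obtain ⟨u, hu⟩ := hXne
  have hxu : x u ∈ X := (MulAction.mem_stabilizer_set.mp hX u).mpr hu
  have hmem : x u ∈ Cᶜ ↔ u ∈ C := by
    rw [← hC, ← Equiv.Perm.smul_def, Set.smul_mem_smul_set_iff]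
  refine hswapsC.eq_top_of_compl hswapsCc hswaps ?_ ?_ <;> by_cases huC : u ∈ C
  exacts [⟨u, huC, hu⟩, ⟨x u, not_not.mp (hmem.not.mpr huC), hxu⟩, ⟨x u, hmem.mpr huC, hxu⟩,
    ⟨u, huC, hu⟩]

theorem subnormalizer_eq_top_of_long_cycle [Finite α] [DecidableEq α] {k : ℕ}
    (hα : Nat.card α = 2 ^ (k + 2)) (hx1 : x ^ 2 ^ (k + 1) = 1) (hfix : ∀ a, x a ≠ a) {d : α}
    (hd : (x ^ 2 ^ k) d ≠ d)
    (ih : ∀ X : Set α, x • X = X → X.ncard = 2 ^ (k + 1) → (∀ a ∈ X, (x ^ 2 ^ k) a = a) →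
      ContainsSwaps (subnormalizer x) X) : subnormalizer x = ⊤ := by
  have hx := isPGroup_zpowers_of_pow_eq_one hx1
  have hperiod {a : α} (ha : (x ^ 2 ^ k) a ≠ a) : Function.minimalPeriod x a = 2 ^ (k + 1) :=
    minimalPeriod_eq_prime_pow ha (by rw [hx1, Equiv.Perm.one_apply])
  set D := {b | x.SameCycle d b}
  have hD : x • D = D := smul_setOf_sameCycle x d
  have hDcard : D.ncard = 2 ^ (k + 1) := (ncard_sameCycle x d).trans (hperiod hd)
  have hα' : Nat.card α = 2 * 2 ^ (k + 1) := by rw [hα, pow_succ']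
  have hDc : x • Dᶜ = Dᶜ := by rw [Set.smul_set_compl, hD]
  have hDccard : Dᶜ.ncard = 2 ^ (k + 1) := ncard_compl_eq_of_card_eq_two_mul hα' hDcard
  have hDcne : Dᶜ.Nonempty := (Set.ncard_pos).mp (hDccard ▸ by positivity)
  by_cases hshort : ∀ a ∈ Dᶜ, (x ^ 2 ^ k) a = a
  · exact subnormalizer_eq_top_of_forall_apply_ne hx hfix hα' hDc hDccard hDcne
      (ih _ hDc hDccard hshort)
  push Not at hshort
  obtain ⟨b, hb, hbne⟩ := hshort
  have hE : Dᶜ = {c | x.SameCycle b c} := (Set.eq_of_subset_of_ncard_le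
    (setOf_sameCycle_subset hDc hb) (by rw [hDccard, ncard_sameCycle, hperiod hbne])).symm
  refine eq_top_of_forall_swap_mem_compl ⟨d, Equiv.Perm.SameCycle.refl x d⟩ hDcne
    fun a ha c hc => swap_mem_subnormalizer_of_minimalPeriod_eq hx
      (fun hac => hc (ha.trans hac)) ?_
  rw [← minimalPeriod_eq_of_sameCycle (show x.SameCycle d a from ha),
    ← minimalPeriod_eq_of_sameCycle (show x.SameCycle b c from hE.le hc), hperiod hd, hperiod hbne]

theorem exists_smul_eq_self_forall_pow_apply_eq_or_ne [Finite α] {k : ℕ}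
    (hα : Nat.card α = 2 ^ (k + 3)) (hx1 : x ^ 2 ^ (k + 1) = 1) :
    ∃ U : Set α, x • U = U ∧ U.ncard = 2 ^ (k + 2) ∧
      ((∀ a ∈ U, (x ^ 2 ^ k) a = a) ∨ ∀ a ∈ U, x a ≠ a) := by
  set F := MulAction.fixedBy α (x ^ 2 ^ k)
  have hF : x • F = F := MulAction.fixedBy_mem_fixedBy_of_commute ((Commute.refl x).pow_left _)
  have hhalf {X : Set α} (hX : x • X = X) (hXcard : 2 ^ (k + 2) ≤ X.ncard) :
      ∃ U ⊆ X, x • U = U ∧ U.ncard = 2 ^ (k + 2) := by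
    rw [pow_succ'] at hXcard ⊢
    exact exists_subset_smul_eq_self_ncard_eq (k + 1) 2 hX (fun a _ => by rw [hx1]; rfl) hXcard
  rcases le_or_gt (2 ^ (k + 2)) F.ncard with hcard | hcard
  · obtain ⟨U, hUF, hU, hUcard⟩ := hhalf hF hcard
    exact ⟨U, hU, hUcard, Or.inl fun a ha => hUF ha⟩
  · obtain ⟨U, hUF, hU, hUcard⟩ := hhalf (X := Fᶜ) (by rw [Set.smul_set_compl, hF]) (by
      have := Set.ncard_add_ncard_compl F
      rw [hα, pow_succ] at this
      lia)
    exact ⟨U, hU, hUcard, Or.inr fun a ha h =>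
      hUF ha (Equiv.Perm.pow_apply_eq_self_of_apply_eq_self h _)⟩

theorem subnormalizer_eq_top_of_short_cycles [Finite α] [DecidableEq α] {k : ℕ}
    (hα : Nat.card α = 2 ^ (k + 3)) (hx1 : x ^ 2 ^ (k + 1) = 1)
    (ih : ∀ X : Set α, x • X = X → X.ncard = 2 ^ (k + 2) →
      ((∀ a ∈ X, (x ^ 2 ^ k) a = a) ∨ ∀ a ∈ X, x a ≠ a) →
      ContainsSwaps (subnormalizer x) X) : subnormalizer x = ⊤ := by
  have hx := isPGroup_zpowers_of_pow_eq_one hx1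
  obtain ⟨U, hU, hUcard, hUor⟩ := exists_smul_eq_self_forall_pow_apply_eq_or_ne hα hx1
  have hUc : x • Uᶜ = Uᶜ := by rw [Set.smul_set_compl, hU]
  have hUccard : Uᶜ.ncard = 2 ^ (k + 2) :=
    ncard_compl_eq_of_card_eq_two_mul (by rw [hα, pow_succ']) hUcard
  have hhalf {X : Set α} (hX : x • X = X) (hXcard : X.ncard = 2 ^ (k + 2)) :
      ∃ Y ⊆ X, x • Y = Y ∧ Y.ncard = 2 ^ (k + 1) := by
    simpa only [one_mul] using exists_subset_smul_eq_self_ncard_eq (p := 2) (k + 1) 1 hX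
      (fun a _ => by rw [hx1]; rfl)
      (by rw [hXcard, one_mul]; exact Nat.pow_le_pow_right two_pos (Nat.le_succ _))
  obtain ⟨Y, hYU, hY, hYcard⟩ := hhalf hU hUcard
  obtain ⟨Z, hZU, hZ, hZcard⟩ := hhalf hUc hUccard
  have hYZcard : (Y ∪ Z).ncard = 2 ^ (k + 2) := by
    rw [Set.ncard_union_eq (Set.disjoint_left.mpr fun a ha hb => hZU hb (hYU ha)), hYcard, hZcard,
      ← mul_two, ← pow_succ]
  have hswaps : ContainsSwaps (subnormalizer x) U := ih U hU hUcard hUor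
  have hswaps' {X : Set α} (hX : x • X = X) (hXcard : X.ncard = 2 ^ (k + 2)) :
      ContainsSwaps (subnormalizer x) X := by
    obtain ⟨σ, hσ, rfl⟩ := exists_mem_subnormalizer_smul_eq_of_ncard_eq hx hU hX
      (hUcard.trans hXcard.symm)
    exact hswaps.smul hσ
  obtain ⟨y, hy⟩ : Y.Nonempty := (Set.ncard_pos).mp (hYcard ▸ by positivity)
  obtain ⟨z, hz⟩ : Z.Nonempty := (Set.ncard_pos).mp (hZcard ▸ by positivity)
  exact hswaps.eq_top_of_compl (hswaps' hUc hUccard)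
    (hswaps' (by rw [Set.smul_set_union, hY, hZ]) hYZcard) ⟨y, hYU hy, Or.inl hy⟩
    ⟨z, hZU hz, Or.inr hz⟩

theorem subnormalizer_eq_top_of_pow_eq_one (k : ℕ) : ∀ {α : Type*} [Finite α] {x : Equiv.Perm α},
    Nat.card α = 2 ^ (k + 1) → x ^ 2 ^ k = 1 → (x ^ 2 ^ (k - 1) = 1 ∨ ∀ a, x a ≠ a) →
    subnormalizer x = ⊤ := by
  induction k with
  | zero =>
    intro α _ x _ hx1 _
    rw [pow_zero, pow_one] at hx1
    rw [hx1, subnormalizer_one]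
  | succ k ih =>
    intro α _ x hα hx1 hor
    classical
    have hx := isPGroup_zpowers_of_pow_eq_one hx1
    have ihX (X : Set α) (hX : x • X = X) (hXcard : X.ncard = 2 ^ (k + 1))
        (hXk : ∀ a ∈ X, (x ^ 2 ^ k) a = a)
        (hXor : (∀ a ∈ X, (x ^ 2 ^ (k - 1)) a = a) ∨ ∀ a ∈ X, x a ≠ a) :
        ContainsSwaps (subnormalizer x) X := by
      have hX' : ∀ a, x a ∈ X ↔ a ∈ X := MulAction.mem_stabilizer_set.mp hX
      refine containsSwaps_of_subnormalizer_subtypePerm_eq_top hX' hx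
        (ih (by rwa [Nat.card_coe_set_eq]) (subtypePerm_pow_eq_one hX' hXk) ?_)
      exact hXor.imp (subtypePerm_pow_eq_one hX') fun h a ha => h a a.2 (congrArg Subtype.val ha)
    by_cases hk : x ^ 2 ^ k = 1
    · rcases k with _ | k
      · rw [pow_zero, pow_one] at hk
        rw [hk, subnormalizer_one]
      · exact subnormalizer_eq_top_of_short_cycles hα hk fun X hX hXcard hXor =>
          ihX X hX hXcard (fun a _ => by rw [hk]; rfl) hXor
    · obtain ⟨d, hd⟩ : ∃ d, (x ^ 2 ^ k) d ≠ d := by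
        by_contra! h
        exact hk (Equiv.ext h)
      have hfix := hor.resolve_left hk
      exact subnormalizer_eq_top_of_long_cycle hα hx1 hfix hd fun X hX hXcard hXk =>
        ihX X hX hXcard hXk (Or.inr fun a _ => hfix a)

end FullSubnormalizer

section SylowSubnormalizer

variable {A : Type*} [Group A] [Finite A] {p : ℕ} [Fact p.Prime]

/-- A subnormalizer that is a `p`-group, as a Sylow `p`-subgroup; it is maximal because it contains
every `p`-subgroup containing `z`. -/
def sylowSubnormalizer {z : A} (hz : IsPGroup p (subnormalizer z)) : Sylow p A where
  toSubgroup := subnormalizer z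
  isPGroup' := hz
  is_maximal' hQ hle :=
    (le_subnormalizer_of_isPGroup hQ (hle (self_mem_subnormalizer z))).antisymm hle

theorem mem_subnormalizer_of_mem_normalizer {z n : A} (hz : IsPGroup p (subnormalizer z))
    (hn : n ∈ normalizer (subnormalizer z : Set A)) : n ∈ subnormalizer z :=
  NormalizesPSubgroup.mem_subnormalizer ⟨_, hz, self_mem_subnormalizer z, hn⟩

/-- The Sylow subgroup `Q = Sub(z)` and its conjugate `u⁻¹Qu` both contain `y`, so they lie in
`Sub(y)` and are conjugate there, while `Q` is self-normalizing. -/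
theorem mem_subnormalizer_of_conj_mem {y z u : A} (hz : IsPGroup p (subnormalizer z))
    (hy : y ∈ subnormalizer z) (hu : u * y * u⁻¹ ∈ subnormalizer z) : u ∈ subnormalizer y := by
  set Q := sylowSubnormalizer hz
  have hQ : (Q : Subgroup A) ≤ subnormalizer y := le_subnormalizer_of_isPGroup hz hy
  have hQu : ((u⁻¹ • Q : Sylow p A) : Subgroup A) ≤ subnormalizer y :=
    le_subnormalizer_of_isPGroup (u⁻¹ • Q : Sylow p A).2 ⟨u * y * u⁻¹, hu, by simp [mul_assoc]⟩
  obtain ⟨h, hh⟩ := MulAction.exists_smul_eq (subnormalizer y) ((u⁻¹ • Q).subtype hQu)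
    (Q.subtype hQ)
  simp_rw [Sylow.smul_subtype, Subgroup.smul_def, smul_smul] at hh
  have hhu : (h : A) * u⁻¹ ∈ subnormalizer z := mem_subnormalizer_of_mem_normalizer hz
    (Sylow.smul_eq_iff_mem_normalizer.mp (Sylow.subtype_injective hh))
  simpa using mul_mem (inv_mem (hQ hhu)) h.2

theorem exists_mem_subnormalizer_conj {y z : A} (hy : IsPGroup p (zpowers y))
    (hz : IsPGroup p (subnormalizer z)) : ∃ c, y ∈ subnormalizer (c * z * c⁻¹) := by
  obtain ⟨P, hP⟩ := hy.exists_le_sylow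
  obtain ⟨c, rfl⟩ := MulAction.exists_smul_eq A (sylowSubnormalizer hz) P
  exact ⟨c, le_subnormalizer_of_isPGroup (c • sylowSubnormalizer hz).2
    ⟨z, self_mem_subnormalizer z, rfl⟩ (hP (mem_zpowers y))⟩

theorem subnormalizer_map_of_injective {B : Type*} [Group B] [Finite B] {φ : A →* B}
    (hφ : Function.Injective φ) {x : A} (hx : IsPGroup p (zpowers x))
    (h : ∀ g, NormalizesPSubgroup p (φ x) g → g ∈ φ.range) :
    subnormalizer (φ x) = (subnormalizer x).map φ := by
  rw [subnormalizer_eq_closure (φ.map_zpowers x ▸ hx.map φ), subnormalizer_eq_closure hx,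
    MonoidHom.map_closure]
  congr 1
  ext g
  constructor
  · intro hg
    obtain ⟨g, rfl⟩ := h g hg
    exact ⟨g, hg.comap hφ, rfl⟩
  · rintro ⟨g, hg, rfl⟩
    exact hg.map φ

end SylowSubnormalizer

section Wreath

open RegularWreathProduct

variable {A : Type*} [Group A]

section BaseGroup

variable {Q : Type*} [Group Q]

/-- The elements of `A ≀ Q` whose components all lie in `H`, that is, the subgroup `H ≀ Q`. -/
def wreathSubgroup (H : Subgroup A) (Q : Type*) [Group Q] : Subgroup (A ≀ᵣ Q) where
  carrier := {w | ∀ r, w.left r ∈ H}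
  mul_mem' ha hb r := mul_mem (ha r) (hb _)
  one_mem' _ := one_mem H
  inv_mem' ha _ := inv_mem (ha _)

/-- The homomorphism from the base group of `A ≀ Q` to `A` that reads off the component at `r`. -/
def baseComponent (r : Q) : (rightHom : A ≀ᵣ Q →* Q).ker →* A where
  toFun w := w.1.left r
  map_one' := rfl
  map_mul' a b := by
    have ha : a.1.right = 1 := a.2
    simp [ha]

theorem left_pow_of_right_eq_one {w : A ≀ᵣ Q} (hw : w.right = 1) (n : ℕ) :
    (w ^ n).left = w.left ^ n :=
  funext fun r => map_pow (baseComponent r) ⟨w, hw⟩ n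

theorem isPGroup_wreathSubgroup [Finite A] {p : ℕ} [Fact p.Prime] {H : Subgroup A}
    (hH : IsPGroup p H) (hQ : IsPGroup p Q) : IsPGroup p (wreathSubgroup H Q) := by
  obtain ⟨n, hn⟩ := isPGroup_iff_exists_pow_pow_eq_one.mp hH
  rintro ⟨w, hw⟩
  obtain ⟨m, hm⟩ := hQ w.right
  have hright : (w ^ p ^ m).right = 1 := (map_pow rightHom w _).trans hm
  refine ⟨m + n, Subtype.ext ?_⟩
  change w ^ p ^ (m + n) = 1
  rw [pow_add, pow_mul]
  refine RegularWreathProduct.ext (funext fun r => ?_) ?_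
  · rw [left_pow_of_right_eq_one hright]
    exact congrArg Subtype.val (hn ⟨_, pow_mem hw (p ^ m) r⟩)
  · change rightHom ((w ^ p ^ m) ^ p ^ n) = 1
    rw [map_pow, show rightHom (w ^ p ^ m) = 1 from hright, one_pow]

theorem NormalizesPSubgroup.left {p : ℕ} {x g : A ≀ᵣ Q} (h : NormalizesPSubgroup p x g)
    (hx : x.right = 1) (hg : g.right = 1) (r : Q) :
    NormalizesPSubgroup p (x.left r) (g.left r) :=
  (NormalizesPSubgroup.comap (φ := (rightHom : A ≀ᵣ Q →* Q).ker.subtype) (x := ⟨x, hx⟩)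
    (g := ⟨g, hg⟩) (subtype_injective _) h).map (baseComponent r)

end BaseGroup

theorem perm_fin_two_eq_one_or_eq_swap (q : Equiv.Perm (Fin 2)) : q = 1 ∨ q = Equiv.swap 0 1 := by
  revert q; decide

theorem perm_fin_two_mul_self (q : Equiv.Perm (Fin 2)) : q * q = 1 := by
  revert q; decide

theorem isPGroup_perm_fin_two : IsPGroup 2 (Equiv.Perm (Fin 2)) :=
  fun q => ⟨1, by rw [pow_one, pow_two, perm_fin_two_mul_self]⟩

/-- The embedding of `A × A` as the base group of `A ≀ S₂`. -/
def baseInclusion : A × A →* A ≀ᵣ Equiv.Perm (Fin 2) where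
  toFun p := ⟨fun r => if r = 1 then p.1 else p.2, 1⟩
  map_one' := RegularWreathProduct.ext (funext fun r => by simp) rfl
  map_mul' a b := RegularWreathProduct.ext (funext fun r => by
    by_cases h : r = 1 <;> simp [h]) (by simp)

theorem baseInclusion_right (y z : A) : (baseInclusion (y, z)).right = 1 := rfl

theorem baseInclusion_left_one (y z : A) : (baseInclusion (y, z)).left 1 = y := rfl

theorem baseInclusion_left_swap (y z : A) :
    (baseInclusion (y, z)).left (Equiv.swap 0 1) = z := rfl

theorem eq_baseInclusion {w : A ≀ᵣ Equiv.Perm (Fin 2)} (hw : w.right = 1) :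
    w = baseInclusion (w.left 1, w.left (Equiv.swap 0 1)) := by
  refine RegularWreathProduct.ext (funext fun r => ?_) hw
  rcases perm_fin_two_eq_one_or_eq_swap r with rfl | rfl <;> rfl

theorem mem_wreathSubgroup_iff {H : Subgroup A} {w : A ≀ᵣ Equiv.Perm (Fin 2)} :
    w ∈ wreathSubgroup H (Equiv.Perm (Fin 2)) ↔
      w.left 1 ∈ H ∧ w.left (Equiv.swap 0 1) ∈ H := by
  refine ⟨fun h => ⟨h _, h _⟩, fun h r => ?_⟩
  rcases perm_fin_two_eq_one_or_eq_swap r with rfl | rfl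
  exacts [h.1, h.2]

theorem baseInclusion_eq_mul (a b : A) :
    baseInclusion (a, b) = baseInclusion (a, 1) *
      (inl (Equiv.swap 0 1) * baseInclusion (b, 1) * inl (Equiv.swap 0 1)) := by
  refine RegularWreathProduct.ext (funext fun r => ?_) ?_
  · rcases perm_fin_two_eq_one_or_eq_swap r with rfl | rfl <;> simp [baseInclusion]
  · simp [baseInclusion]

variable {y z : A}

theorem baseInclusion_mem_wreathSubgroup (hy : y ∈ subnormalizer z) :
    baseInclusion (y, z) ∈ wreathSubgroup (subnormalizer z) (Equiv.Perm (Fin 2)) :=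
  mem_wreathSubgroup_iff.mpr ⟨hy, self_mem_subnormalizer z⟩

variable [Finite A]

theorem mem_wreathSubgroup_of_normalizesPSubgroup (hz : IsPGroup 2 (subnormalizer z))
    (hy : y ∈ subnormalizer z) {g : A ≀ᵣ Equiv.Perm (Fin 2)}
    (h : NormalizesPSubgroup 2 (baseInclusion (y, z)) g) :
    g ∈ wreathSubgroup (subnormalizer y) (Equiv.Perm (Fin 2)) := by
  have hle : subnormalizer z ≤ subnormalizer y := le_subnormalizer_of_isPGroup hz hy
  rcases perm_fin_two_eq_one_or_eq_swap g.right with hg | hg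
  · exact mem_wreathSubgroup_iff.mpr ⟨(h.left rfl hg 1).mem_subnormalizer,
      hle (h.left rfl hg (Equiv.swap 0 1)).mem_subnormalizer⟩
  obtain ⟨N, hN, hxN, hgN⟩ := h
  have hconj : NormalizesPSubgroup 2 (baseInclusion (y, z)) (g * baseInclusion (y, z) * g⁻¹) :=
    ⟨N, hN, hxN, le_normalizer ((mem_normalizer_iff.mp hgN _).mp hxN)⟩
  have hswap : g.left (Equiv.swap 0 1) ∈ subnormalizer y := by
    refine mem_subnormalizer_of_conj_mem hz hy ?_
    simpa [hg, baseInclusion] using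
      (hconj.left rfl (by simp [baseInclusion_right]) (Equiv.swap 0 1)).mem_subnormalizer
  have hsq : NormalizesPSubgroup 2 (baseInclusion (y, z)) (g * g) :=
    ⟨N, hN, hxN, mul_mem hgN hgN⟩
  have hmul : g.left (Equiv.swap 0 1) * g.left 1 ∈ subnormalizer y := by
    simpa [hg] using hle (hsq.left rfl (by simp [perm_fin_two_mul_self])
      (Equiv.swap 0 1)).mem_subnormalizer
  exact mem_wreathSubgroup_iff.mpr ⟨by simpa using mul_mem (inv_mem hswap) hmul, hswap⟩

theorem inl_mem_subnormalizer_baseInclusion (hz : IsPGroup 2 (subnormalizer z))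
    (hy : y ∈ subnormalizer z) (q : Equiv.Perm (Fin 2)) :
    inl q ∈ subnormalizer (baseInclusion (y, z)) :=
  le_subnormalizer_of_isPGroup (isPGroup_wreathSubgroup hz isPGroup_perm_fin_two)
    (baseInclusion_mem_wreathSubgroup hy) fun _ => one_mem _

theorem baseInclusion_mem_subnormalizer (hy : IsPGroup 2 (zpowers y))
    (hz : IsPGroup 2 (zpowers z)) {g : A} (hg : g ∈ subnormalizer y) :
    baseInclusion (g, 1) ∈ subnormalizer (baseInclusion (y, z)) := by
  suffices subnormalizer y ≤
      (subnormalizer (baseInclusion (y, z))).comap (baseInclusion.comp (MonoidHom.inl A A)) from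
    this hg
  exact (subnormalizer_le_iff hy).mpr fun _ h => (h.map_prod baseInclusion hz).mem_subnormalizer

theorem wreathSubgroup_le_subnormalizer (hz : IsPGroup 2 (subnormalizer z))
    (hy : y ∈ subnormalizer z) :
    wreathSubgroup (subnormalizer y) (Equiv.Perm (Fin 2)) ≤
      subnormalizer (baseInclusion (y, z)) := by
  have hinl := inl_mem_subnormalizer_baseInclusion hz hy
  have hleft {a : A} (ha : a ∈ subnormalizer y) :
      baseInclusion (a, 1) ∈ subnormalizer (baseInclusion (y, z)) :=
    baseInclusion_mem_subnormalizer (hz.to_le (zpowers_le.mpr hy))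
      (hz.to_le (zpowers_le.mpr (self_mem_subnormalizer z))) ha
  intro w hw
  have hbase : w * inl w.right⁻¹ ∈ subnormalizer (baseInclusion (y, z)) := by
    rw [(eq_baseInclusion (w := w * inl w.right⁻¹) (by simp)).trans (baseInclusion_eq_mul _ _)]
    exact mul_mem (hleft (by simpa using hw 1))
      (mul_mem (mul_mem (hinl _) (hleft (by simpa using hw (Equiv.swap 0 1)))) (hinl _))
  simpa [mul_assoc, ← map_mul] using mul_mem hbase (hinl w.right)

theorem subnormalizer_baseInclusion (hz : IsPGroup 2 (subnormalizer z))
    (hy : y ∈ subnormalizer z) :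
    subnormalizer (baseInclusion (y, z)) =
      wreathSubgroup (subnormalizer y) (Equiv.Perm (Fin 2)) := by
  have hx : IsPGroup 2 (zpowers (baseInclusion (y, z))) :=
    (isPGroup_wreathSubgroup hz isPGroup_perm_fin_two).to_le
      (zpowers_le.mpr (baseInclusion_mem_wreathSubgroup hy))
  exact ((subnormalizer_le_iff hx).mpr fun _ hg =>
    mem_wreathSubgroup_of_normalizesPSubgroup hz hy hg).antisymm
      (wreathSubgroup_le_subnormalizer hz hy)

end Wreath

section ShortCycles

variable {α : Type*}

theorem cycleFactorsFinset_shortCycleProduct [Fintype α] [DecidableEq α] (x : Equiv.Perm α)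
    (m : ℕ) : (shortCycleProduct x m).cycleFactorsFinset =
      x.cycleFactorsFinset.filter fun c => c.support.card < m :=
  Equiv.Perm.cycleFactorsFinset_eq_finset.mpr
    ⟨fun _ hc => (Equiv.Perm.mem_cycleFactorsFinset_iff.mp (Finset.mem_filter.mp hc).1).1,
      x.cycleFactorsFinset_pairwise_disjoint.mono (Finset.filter_subset _ _), rfl⟩

theorem card_support_cycleOf [Fintype α] [DecidableEq α] {x : Equiv.Perm α} {a : α}
    (ha : x a ≠ a) : (x.cycleOf a).support.card = Function.minimalPeriod x a := by
  rw [← ncard_sameCycle, ← Set.ncard_coe_finset]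
  congr 1
  ext b
  rw [Finset.mem_coe, Equiv.Perm.mem_support_cycleOf_iff, Equiv.Perm.mem_support,
    and_iff_left ha, Set.mem_ofPred_eq]

theorem shortCycleProduct_apply [Fintype α] [DecidableEq α] {x : Equiv.Perm α} {m : ℕ} {a : α}
    (ha : a ∈ shortCyclePoints x m) : shortCycleProduct x m a = x a := by
  have hfactors := cycleFactorsFinset_shortCycleProduct x m
  by_cases hxa : x a = a
  · rw [hxa, ← Equiv.Perm.notMem_support,
      Equiv.Perm.mem_support_iff_mem_support_of_mem_cycleFactorsFinset, hfactors]
    rintro ⟨c, hc, hac⟩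
    exact Equiv.Perm.mem_support.mp (Equiv.Perm.mem_cycleFactorsFinset_support_le
      (Finset.mem_filter.mp hc).1 hac) hxa
  · have hc : x.cycleOf a ∈ (shortCycleProduct x m).cycleFactorsFinset := by
      rw [hfactors, Finset.mem_filter, card_support_cycleOf hxa,
        Equiv.Perm.cycleOf_mem_cycleFactorsFinset_iff, Equiv.Perm.mem_support]
      exact ⟨hxa, ha⟩
    have hac : a ∈ (x.cycleOf a).support :=
      Equiv.Perm.mem_support_cycleOf_iff.mpr ⟨.refl x a, Equiv.Perm.mem_support.mpr hxa⟩
    rw [← (Equiv.Perm.mem_cycleFactorsFinset_iff.mp hc).2 a hac, Equiv.Perm.cycleOf_apply_self]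

theorem shortCyclePoints_eq_compl [Finite α] {m : ℕ} {x : Equiv.Perm α}
    (hα : Nat.card α = 2 * m) (hm : 1 < m) {a d : α} (ha : x a = a)
    (hd : Function.minimalPeriod x d = m) :
    shortCyclePoints x m = {b | x.SameCycle d b}ᶜ := by
  set D := {b | x.SameCycle d b}
  have hDm : Dᶜ.ncard = m := ncard_compl_eq_of_card_eq_two_mul hα (by rw [ncard_sameCycle, hd])
  have hfix : Function.minimalPeriod x a = 1 := Function.minimalPeriod_eq_one_iff_isFixedPt.mpr ha
  have hnot {b : α} (hb : Function.minimalPeriod x b = m) : ¬ x.SameCycle b a := fun h => by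
    rw [minimalPeriod_eq_of_sameCycle h, hfix] at hb
    exact hm.ne hb
  ext b
  constructor
  · intro (hb : Function.minimalPeriod x b < m) hdb
    exact hb.ne ((minimalPeriod_eq_of_sameCycle hdb).symm.trans hd)
  · intro hb
    have hsub : {c | x.SameCycle b c} ⊆ Dᶜ :=
      setOf_sameCycle_subset (by rw [Set.smul_set_compl, smul_setOf_sameCycle]) hb
    have hle := Set.ncard_le_ncard hsub
    rw [hDm, ncard_sameCycle] at hle
    refine lt_of_le_of_ne hle fun hbm => hnot hbm ?_
    have heq := Set.eq_of_subset_of_ncard_le hsub (by rw [hDm, ncard_sameCycle, hbm])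
    exact heq.ge (hnot hd)

theorem smul_shortCyclePoints (x : Equiv.Perm α) (m : ℕ) :
    x • shortCyclePoints x m = shortCyclePoints x m :=
  MulAction.mem_stabilizer_set.mpr fun a =>
    iff_of_eq (congrArg (· < m) (minimalPeriod_eq_of_sameCycle
      (Equiv.Perm.sameCycle_apply_left.mpr (.refl x a))))

theorem sameCycle_of_mem_compl_shortCyclePoints [Finite α] {m : ℕ} {x : Equiv.Perm α}
    (hα : Nat.card α = 2 * m) (hm : 1 < m) {a d : α} (ha : x a = a)
    (hd : Function.minimalPeriod x d = m) :
    ∀ b ∈ (shortCyclePoints x m)ᶜ, ∀ c ∈ (shortCyclePoints x m)ᶜ, x.SameCycle b c := by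
  rw [shortCyclePoints_eq_compl hα hm ha hd, compl_compl]
  exact fun b hb c hc => Equiv.Perm.SameCycle.trans (Equiv.Perm.SameCycle.symm hb) hc

theorem ncard_shortCyclePoints [Finite α] {m : ℕ} {x : Equiv.Perm α}
    (hα : Nat.card α = 2 * m) (hm : 1 < m) {a d : α} (ha : x a = a)
    (hd : Function.minimalPeriod x d = m) : (shortCyclePoints x m).ncard = m := by
  rw [shortCyclePoints_eq_compl hα hm ha hd]
  exact ncard_compl_eq_of_card_eq_two_mul hα (by rw [ncard_sameCycle, hd])

end ShortCycles

section HalfCycle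

variable {α : Type*} {x : Equiv.Perm α} {Ω : Set α}

theorem eq_or_eq_compl_of_smul_eq_self [Finite α] (hcyc : ∀ a ∈ Ωᶜ, ∀ b ∈ Ωᶜ, x.SameCycle a b)
    (hcard : Ω.ncard = Ωᶜ.ncard) {X : Set α} (hX : x • X = X) (hXcard : X.ncard = Ω.ncard) :
    X = Ω ∨ X = Ωᶜ := by
  by_cases h : X ⊆ Ω
  · exact Or.inl (Set.eq_of_subset_of_ncard_le h hXcard.ge)
  · obtain ⟨d, hdX, hd⟩ := Set.not_subset.mp h
    exact Or.inr (Set.eq_of_subset_of_ncard_le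
      (fun b hb => setOf_sameCycle_subset hX hdX (hcyc d hd b hb)) (hXcard.trans hcard).le).symm

theorem mem_stabilizer_pair_compl_iff {g : Equiv.Perm α} :
    g ∈ MulAction.stabilizer (Equiv.Perm α) ({Ω, Ωᶜ} : Set (Set α)) ↔ g • Ω = Ω ∨ g • Ω = Ωᶜ := by
  rw [MulAction.mem_stabilizer_iff, Set.smul_set_insert, Set.smul_set_singleton,
    Set.pair_eq_pair_iff, Set.smul_set_compl]
  exact or_congr (and_iff_left_of_imp fun h => by rw [h])
    (and_iff_left_of_imp fun h => by rw [h, compl_compl])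

theorem stabilizer_pair_compl_ne_top (hΩ : Ω.Nontrivial) (hΩc : Ωᶜ.Nonempty) :
    MulAction.stabilizer (Equiv.Perm α) ({Ω, Ωᶜ} : Set (Set α)) ≠ ⊤ := by
  classical
  obtain ⟨a, ha, b, hb, hab⟩ := hΩ
  obtain ⟨c, hc⟩ := hΩc
  intro htop
  have hcΩ : c ∈ Equiv.swap a c • Ω := ⟨a, ha, Equiv.swap_apply_left a c⟩
  have hbΩ : b ∈ Equiv.swap a c • Ω :=
    ⟨b, hb, Equiv.swap_apply_of_ne_of_ne hab.symm (fun h => hc (h ▸ hb))⟩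
  rcases mem_stabilizer_pair_compl_iff.mp (htop.ge (mem_top (Equiv.swap a c))) with h | h
  · exact hc (h ▸ hcΩ)
  · exact (h ▸ hbΩ : b ∈ Ωᶜ) hb

/-- For `n` normalizing a subgroup of the stabilizer that contains `x`, the conjugate `n⁻¹xn` has a
fixed point, so it cannot exchange `Ω` and `Ωᶜ`; hence `x` preserves `n • Ω`, and there are only
two `x`-invariant sets of that size. -/
theorem NormalizesPSubgroup.mem_stabilizer_pair_compl [Finite α] {p : ℕ} [Fact p.Prime]
    {g : Equiv.Perm α} (hg : NormalizesPSubgroup p x g) (hΩ : x • Ω = Ω)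
    (hcyc : ∀ a ∈ Ωᶜ, ∀ b ∈ Ωᶜ, x.SameCycle a b) (hcard : Ω.ncard = Ωᶜ.ncard) {a : α}
    (ha : x a = a) : g ∈ MulAction.stabilizer (Equiv.Perm α) ({Ω, Ωᶜ} : Set (Set α)) := by
  refine hg.mem_of_normalizer_le (mem_stabilizer_pair_compl_iff.mpr (Or.inl hΩ))
    fun M hM hxM n hn => mem_stabilizer_pair_compl_iff.mpr ?_
  have hconj : n⁻¹ * x * n ∈ M := (mem_normalizer_iff''.mp hn x).mp hxM
  have hfix : (n⁻¹ * x * n) • (n⁻¹ • a) = n⁻¹ • a := by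
    rw [smul_smul, mul_assoc, mul_inv_cancel, mul_one, mul_smul, Equiv.Perm.smul_def x, ha]
  have hconjΩ : (n⁻¹ * x * n) • Ω = Ω := by
    refine (mem_stabilizer_pair_compl_iff.mp (hM hconj)).resolve_right fun h => ?_
    have hmem : n⁻¹ • a ∈ (n⁻¹ * x * n) • Ω ↔ n⁻¹ • a ∈ Ω := by
      conv_lhs => rw [← hfix, Set.smul_mem_smul_set_iff]
    rw [h, Set.mem_compl_iff] at hmem
    tauto
  rw [mul_assoc, mul_smul, inv_smul_eq_iff, mul_smul] at hconjΩ
  exact eq_or_eq_compl_of_smul_eq_self hcyc hcard hconjΩ (Set.ncard_smul_set n Ω)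

theorem subnormalizer_ne_top_of_smul_eq_self [Finite α] {p : ℕ} [Fact p.Prime]
    (hx : IsPGroup p (zpowers x)) (hΩ : x • Ω = Ω)
    (hcyc : ∀ a ∈ Ωᶜ, ∀ b ∈ Ωᶜ, x.SameCycle a b) (hcard : Ω.ncard = Ωᶜ.ncard)
    (hΩ1 : 1 < Ω.ncard) {a : α} (ha : x a = a) : subnormalizer x ≠ ⊤ := by
  have hle : subnormalizer x ≤ MulAction.stabilizer (Equiv.Perm α) ({Ω, Ωᶜ} : Set (Set α)) :=
    (subnormalizer_le_iff hx).mpr fun _ hg => hg.mem_stabilizer_pair_compl hΩ hcyc hcard ha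
  exact ne_top_of_le_ne_top (stabilizer_pair_compl_ne_top (Set.one_lt_ncard_iff_nontrivial.mp hΩ1)
    ((Set.ncard_pos).mp (by lia))) hle

end HalfCycle

section ImprimitiveWreath

open RegularWreathProduct

variable {Ω Δ α : Type*}

/-- The imprimitive action of `Sym(Ω) ≀ S₂` on `α`, identified by `f` with two copies of `Ω`. -/
def wreathRep (f : Ω × Equiv.Perm (Fin 2) ≃ α) :
    Equiv.Perm Ω ≀ᵣ Equiv.Perm (Fin 2) →* Equiv.Perm α :=
  f.permCongrHom.toMonoidHom.comp (toPerm (Equiv.Perm Ω) (Equiv.Perm (Fin 2)) Ω)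

theorem wreathRep_injective [Nonempty Ω] (f : Ω × Equiv.Perm (Fin 2) ≃ α) :
    Function.Injective (wreathRep f) :=
  f.permCongrHom.injective.comp (toPermInj (Equiv.Perm Ω) (Equiv.Perm (Fin 2)) Ω)

theorem wreathRep_apply (f : Ω × Equiv.Perm (Fin 2) ≃ α)
    (w : Equiv.Perm Ω ≀ᵣ Equiv.Perm (Fin 2)) (a : Ω) (r : Equiv.Perm (Fin 2)) :
    wreathRep f w (f (a, r)) = f (w.left (w.right * r) a, w.right * r) := by
  change f (w • f.symm (f (a, r))) = _
  rw [Equiv.symm_apply_apply]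
  rfl

theorem wreathS2_eq_map_wreathRep (H : Subgroup (Equiv.Perm Ω))
    (f : Ω × Equiv.Perm (Fin 2) ≃ α) :
    wreathS2 H f = (wreathSubgroup H (Equiv.Perm (Fin 2))).map (wreathRep f) := by
  ext σ
  constructor
  · rintro ⟨w, rfl⟩
    exact ⟨⟨fun r => w.left r, w.right⟩, fun r => (w.left r).2, rfl⟩
  · rintro ⟨w, hw, rfl⟩
    exact ⟨⟨fun r => ⟨w.left r, hw r⟩, w.right⟩, rfl⟩

theorem mem_range_wreathRep [Finite Ω] (f : Ω × Equiv.Perm (Fin 2) ≃ α) {g : Equiv.Perm α}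
    {q : Equiv.Perm (Fin 2)} (h : ∀ a r, (f.symm (g (f (a, r)))).2 = q * r) :
    g ∈ (wreathRep f).range := by
  have hinj (r) : Function.Injective fun a : Ω => (f.symm (g (f (a, q⁻¹ * r)))).1 := by
    intro a b hab
    have : f.symm (g (f (a, q⁻¹ * r))) = f.symm (g (f (b, q⁻¹ * r))) :=
      Prod.ext hab (by rw [h, h])
    simpa using this
  refine ⟨⟨fun r => Equiv.ofBijective _ (Finite.injective_iff_bijective.mp (hinj r)), q⟩,
    Equiv.ext fun b => ?_⟩
  obtain ⟨⟨a, r⟩, rfl⟩ := f.surjective b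
  rw [wreathRep_apply, ← Equiv.eq_symm_apply]
  simp only [Equiv.ofBijective_apply, inv_mul_cancel_left]
  exact Prod.ext rfl (h a r).symm

theorem subnormalizer_wreathRep_baseInclusion [Finite α] [Finite Ω] [Nonempty Ω]
    (f : Ω × Equiv.Perm (Fin 2) ≃ α) {y z : Equiv.Perm Ω} (hz : IsPGroup 2 (subnormalizer z))
    (hy : y ∈ subnormalizer z)
    (h : ∀ g, NormalizesPSubgroup 2 (wreathRep f (baseInclusion (y, z))) g →
      g ∈ (wreathRep f).range) :
    subnormalizer (wreathRep f (baseInclusion (y, z))) = wreathS2 (subnormalizer y) f := by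
  have hx := (isPGroup_wreathSubgroup hz isPGroup_perm_fin_two).to_le
    (zpowers_le.mpr (baseInclusion_mem_wreathSubgroup hy))
  rw [subnormalizer_map_of_injective (wreathRep_injective f) hx h,
    subnormalizer_baseInclusion hz hy, wreathS2_eq_map_wreathRep]

theorem exists_equiv_mem_subnormalizer_permCongr [Finite Ω] {n : ℕ} {y : Equiv.Perm Ω}
    {z : Equiv.Perm Δ} (hy : IsPGroup 2 (zpowers y)) (hz : ∀ a b, z.SameCycle a b)
    (hz1 : z ^ 2 ^ n = 1) (e₀ : Ω ≃ Δ) :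
    ∃ e : Ω ≃ Δ, IsPGroup 2 (subnormalizer (e.symm.permCongr z)) ∧
      y ∈ subnormalizer (e.symm.permCongr z) := by
  have hp (e : Ω ≃ Δ) : IsPGroup 2 (subnormalizer (e.symm.permCongr z)) := by
    refine isPGroup_subnormalizer_of_sameCycle (n := n) (fun a b => ?_) ?_
    · obtain ⟨i, hi⟩ := hz (e a) (e b)
      refine ⟨i, ?_⟩
      rw [← Equiv.permCongrHom_coe, ← map_zpow, Equiv.permCongrHom_coe, Equiv.permCongr_apply,
        Equiv.symm_symm, hi, Equiv.symm_apply_apply]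
    · rw [← Equiv.permCongrHom_coe, ← map_pow, hz1, map_one]
  obtain ⟨c, hc⟩ := exists_mem_subnormalizer_conj hy (hp e₀)
  have hconj : c * e₀.symm.permCongr z * c⁻¹ = (c.symm.trans e₀).symm.permCongr z := by
    rw [← Equiv.permCongr_eq_mul]
    rfl
  exact ⟨c.symm.trans e₀, hp _, hconj ▸ hc⟩

end ImprimitiveWreath

section Double

variable {α : Type*} {Ω : Set α}

/-- The identification of `α` with two copies of `Ω` given by `e : Ω ≃ Ωᶜ`. -/
noncomputable def doubleEquiv (e : Ω ≃ (Ωᶜ : Set α)) : Ω × Equiv.Perm (Fin 2) ≃ α :=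
  Equiv.ofBijective (fun p => if p.2 = 1 then (p.1 : α) else e p.1) (by
    classical
    constructor
    · rintro ⟨a, r⟩ ⟨b, s⟩ hab
      rcases perm_fin_two_eq_one_or_eq_swap r with rfl | rfl <;>
        rcases perm_fin_two_eq_one_or_eq_swap s with rfl | rfl
      · simpa [Subtype.ext_iff] using hab
      · have hab' : (a : α) = e b := by simpa using hab
        exact absurd a.2 (hab' ▸ (e b).2)
      · have hab' : (e a : α) = b := by simpa using hab
        exact absurd b.2 (hab' ▸ (e a).2)
      · simpa [← Subtype.ext_iff] using hab
    · intro b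
      by_cases hb : b ∈ Ω
      · exact ⟨(⟨b, hb⟩, 1), by simp⟩
      · exact ⟨(e.symm ⟨b, hb⟩, Equiv.swap 0 1), by simp⟩)

theorem doubleEquiv_one (e : Ω ≃ (Ωᶜ : Set α)) (a : Ω) : doubleEquiv e (a, 1) = a := by
  change (if (1 : Equiv.Perm (Fin 2)) = 1 then (a : α) else e a) = a
  exact if_pos rfl

theorem doubleEquiv_swap (e : Ω ≃ (Ωᶜ : Set α)) (a : Ω) :
    doubleEquiv e (a, Equiv.swap 0 1) = e a := by
  change (if (Equiv.swap 0 1 : Equiv.Perm (Fin 2)) = 1 then (a : α) else e a) = e a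
  exact if_neg (by decide)

theorem doubleEquiv_symm_snd_eq_one_iff (e : Ω ≃ (Ωᶜ : Set α)) (b : α) :
    ((doubleEquiv e).symm b).2 = 1 ↔ b ∈ Ω := by
  obtain ⟨⟨a, r⟩, rfl⟩ := (doubleEquiv e).surjective b
  rw [Equiv.symm_apply_apply]
  rcases perm_fin_two_eq_one_or_eq_swap r with rfl | rfl
  · simp [doubleEquiv_one]
  · rw [doubleEquiv_swap]
    exact iff_of_false (show (Equiv.swap 0 1 : Equiv.Perm (Fin 2)) ≠ 1 by decide) (e a).2

theorem mem_range_wreathRep_doubleEquiv [Finite α] (e : Ω ≃ (Ωᶜ : Set α)) {g : Equiv.Perm α}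
    (h : g ∈ MulAction.stabilizer (Equiv.Perm α) ({Ω, Ωᶜ} : Set (Set α))) :
    g ∈ (wreathRep (doubleEquiv e)).range := by
  have heq : ∀ q r : Equiv.Perm (Fin 2), (q = 1 ↔ r = 1) → q = 1 * r := by decide
  have hne : ∀ q r : Equiv.Perm (Fin 2), (q = 1 ↔ ¬ r = 1) → q = Equiv.swap 0 1 * r := by decide
  have hmem (b : α) : g b ∈ g • Ω ↔ b ∈ Ω := Set.smul_mem_smul_set_iff
  have hsnd (p : Ω × Equiv.Perm (Fin 2)) : p.2 = 1 ↔ g (doubleEquiv e p) ∈ g • Ω := by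
    rw [hmem, ← doubleEquiv_symm_snd_eq_one_iff e, Equiv.symm_apply_apply]
  rcases mem_stabilizer_pair_compl_iff.mp h with h | h
  · refine mem_range_wreathRep (doubleEquiv e) fun a r => heq _ _ ?_
    rw [doubleEquiv_symm_snd_eq_one_iff, hsnd (a, r), h]
  · refine mem_range_wreathRep (doubleEquiv e) fun a r => hne _ _ ?_
    rw [doubleEquiv_symm_snd_eq_one_iff, hsnd (a, r), h, Set.notMem_compl_iff]

theorem wreathRep_doubleEquiv_baseInclusion {x : Equiv.Perm α} (e : Ω ≃ (Ωᶜ : Set α))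
    (hΩ : ∀ a, x a ∈ Ω ↔ a ∈ Ω) (hΩc : ∀ a, x a ∈ Ωᶜ ↔ a ∈ Ωᶜ) :
    wreathRep (doubleEquiv e)
      (baseInclusion (x.subtypePerm hΩ, e.symm.permCongr (x.subtypePerm hΩc))) = x := by
  ext b
  obtain ⟨⟨a, r⟩, rfl⟩ := (doubleEquiv e).surjective b
  rw [wreathRep_apply, baseInclusion_right, one_mul]
  rcases perm_fin_two_eq_one_or_eq_swap r with rfl | rfl
  · rw [baseInclusion_left_one, doubleEquiv_one, doubleEquiv_one, Equiv.Perm.subtypePerm_apply]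
  · simp only [baseInclusion_left_swap, doubleEquiv_swap, Equiv.permCongr_apply, Equiv.symm_symm,
      Equiv.apply_symm_apply, Equiv.Perm.subtypePerm_apply]

theorem exists_subnormalizer_eq_wreathS2 [Finite α] {n : ℕ} {x : Equiv.Perm α}
    (hx : x ^ 2 ^ n = 1) (hΩ : ∀ a, x a ∈ Ω ↔ a ∈ Ω)
    (hcyc : ∀ a ∈ Ωᶜ, ∀ b ∈ Ωᶜ, x.SameCycle a b) (hcard : Ω.ncard = Ωᶜ.ncard)
    (hΩne : Ω.Nonempty) {a : α} (ha : x a = a) :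
    ∃ f : Ω × Equiv.Perm (Fin 2) ≃ α, (∀ a, f (a, 1) = a) ∧
      subnormalizer x = wreathS2 (subnormalizer (x.subtypePerm hΩ)) f := by
  have : Nonempty Ω := hΩne.to_subtype
  have hΩc (a : α) : x a ∈ Ωᶜ ↔ a ∈ Ωᶜ := not_congr (hΩ a)
  obtain ⟨e₀⟩ : Nonempty (Ω ≃ (Ωᶜ : Set α)) := Finite.card_eq.mp hcard
  have hsame (a b : (Ωᶜ : Set α)) : (x.subtypePerm hΩc).SameCycle a b :=
    Equiv.Perm.sameCycle_subtypePerm.mpr (hcyc a a.2 b b.2)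
  have hpow : x.subtypePerm hΩc ^ 2 ^ n = 1 :=
    subtypePerm_pow_eq_one hΩc fun _ _ => by rw [hx, Equiv.Perm.one_apply]
  obtain ⟨e, hz, hy⟩ := exists_equiv_mem_subnormalizer_permCongr
    (isPGroup_zpowers_subtypePerm hΩ (isPGroup_zpowers_of_pow_eq_one hx)) hsame hpow e₀
  have hxe := wreathRep_doubleEquiv_baseInclusion e hΩ hΩc
  have hsub := subnormalizer_wreathRep_baseInclusion (doubleEquiv e) hz hy fun g hg =>
    mem_range_wreathRep_doubleEquiv e <| (hxe ▸ hg).mem_stabilizer_pair_compl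
      (MulAction.mem_stabilizer_set.mpr hΩ) hcyc hcard ha
  rw [hxe] at hsub
  exact ⟨doubleEquiv e, doubleEquiv_one e, hsub⟩

end Double

section TwoPowerDegree

variable {α : Type*}

theorem not_isPGroup_two_perm [Finite α] (h : 3 ≤ Nat.card α) :
    ¬ IsPGroup 2 (⊤ : Subgroup (Equiv.Perm α)) := by
  intro hp
  obtain ⟨m, hm⟩ := IsPGroup.iff_card.mp hp
  rw [Subgroup.card_top, Nat.card_perm] at hm
  have h3 : 3 ∣ 2 ^ m := hm ▸ Nat.dvd_factorial (by norm_num) h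
  exact absurd (Nat.prime_three.dvd_of_dvd_pow h3) (by norm_num)

theorem sameCycle_of_isCycle_of_card_support [Fintype α] [DecidableEq α] {x : Equiv.Perm α}
    (hx : x.IsCycle) (hcard : x.support.card = Fintype.card α) (a b : α) : x.SameCycle a b := by
  have hsupp (c : α) : x c ≠ c :=
    Equiv.Perm.mem_support.mp (((Finset.card_eq_iff_eq_univ _).mp hcard).ge (Finset.mem_univ c))
  exact hx.sameCycle (hsupp a) (hsupp b)

theorem isCycle_or_pow_eq_one [Fintype α] [DecidableEq α] {p k m : ℕ} [Fact p.Prime]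
    {x : Equiv.Perm α} (hα : Fintype.card α = p ^ (k + 1)) (hx : x ^ p ^ m = 1) :
    (x.IsCycle ∧ x.support.card = p ^ (k + 1)) ∨ x ^ p ^ k = 1 := by
  rw [or_iff_not_imp_right]
  intro hne
  obtain ⟨a, ha⟩ : ∃ a, (x ^ p ^ k) a ≠ a := by
    by_contra! h
    exact hne (Equiv.ext h)
  have hdvd (i : ℕ) : (x ^ p ^ i) a = a ↔ Function.minimalPeriod x a ∣ p ^ i := by
    rw [← Int.natCast_dvd_natCast, ← zpow_apply_eq_self_iff, zpow_natCast]
  obtain ⟨j, -, hj⟩ := (Nat.dvd_prime_pow Fact.out).mp ((hdvd m).mp (by rw [hx]; rfl))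
  have hkj : k + 1 ≤ j := by
    by_contra! hlt
    exact ha ((hdvd k).mpr (hj ▸ pow_dvd_pow p (Nat.le_of_lt_succ hlt)))
  have huniv : {b | x.SameCycle a b} = Set.univ := by
    refine Set.eq_of_subset_of_ncard_le (Set.subset_univ _) ?_
    rw [Set.ncard_univ, Nat.card_eq_fintype_card, hα, ncard_sameCycle, hj]
    exact Nat.pow_le_pow_right (Nat.Prime.pos Fact.out) hkj
  have hsame (b : α) : x.SameCycle a b := huniv.ge (Set.mem_univ b)
  have hxa : x a ≠ a := fun h => ha (Equiv.Perm.pow_apply_eq_self_of_apply_eq_self h _)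
  refine ⟨⟨a, hxa, fun b _ => hsame b⟩, ?_⟩
  rw [← hα, Finset.card_eq_iff_eq_univ, Finset.eq_univ_iff_forall]
  exact fun b => Equiv.Perm.mem_support.mpr ((hsame b).apply_eq_self_iff.not.mp hxa)

theorem exists_minimalPeriod_eq_of_orderOf {p n : ℕ} [Fact p.Prime] {x : Equiv.Perm α}
    (hx : orderOf x = p ^ (n + 1)) : ∃ d, Function.minimalPeriod x d = p ^ (n + 1) := by
  have hx1 : x ^ p ^ (n + 1) = 1 := hx ▸ pow_orderOf_eq_one x
  by_contra! h
  have hpow : x ^ p ^ n = 1 := Equiv.ext fun a => by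
    by_contra ha
    exact h a (minimalPeriod_eq_prime_pow ha (by rw [hx1]; rfl))
  have hdvd : p ^ (n + 1) ∣ p ^ n := hx ▸ orderOf_dvd_of_pow_eq_one hpow
  exact n.not_succ_le_self ((Nat.pow_dvd_pow_iff_le_right (Nat.Prime.one_lt Fact.out)).mp hdvd)

theorem subnormalizer_ne_top_of_isCycle [Fintype α] [DecidableEq α] {n : ℕ} {x : Equiv.Perm α}
    (hα : 3 ≤ Fintype.card α) (hx : x ^ 2 ^ n = 1) (hcyc : x.IsCycle)
    (hcard : x.support.card = Fintype.card α) : subnormalizer x ≠ ⊤ := fun htop =>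
  not_isPGroup_two_perm (hα.trans_eq Nat.card_eq_fintype_card.symm) <| htop ▸
    isPGroup_subnormalizer_of_sameCycle (sameCycle_of_isCycle_of_card_support hcyc hcard) hx

theorem subnormalizer_ne_top_of_orderOf [Finite α] {n : ℕ} {x : Equiv.Perm α}
    (hα : Nat.card α = 2 * 2 ^ (n + 1)) (hx : orderOf x = 2 ^ (n + 1)) {a : α} (ha : x a = a) :
    subnormalizer x ≠ ⊤ := by
  obtain ⟨d, hd⟩ := exists_minimalPeriod_eq_of_orderOf hx
  have hm : 1 < 2 ^ (n + 1) := Nat.one_lt_two_pow n.succ_ne_zero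
  have hΩ := ncard_shortCyclePoints hα hm ha hd
  exact subnormalizer_ne_top_of_smul_eq_self
    (isPGroup_zpowers_of_pow_eq_one (hx ▸ pow_orderOf_eq_one x)) (smul_shortCyclePoints x _)
    (sameCycle_of_mem_compl_shortCyclePoints hα hm ha hd)
    (hΩ.trans (ncard_compl_eq_of_card_eq_two_mul hα hΩ).symm) (hΩ.symm ▸ hm) ha

theorem exists_subnormalizer_eq_wreathS2_shortCycleProduct [Fintype α] [DecidableEq α] {n : ℕ}
    {x : Equiv.Perm α} (hα : Nat.card α = 2 * 2 ^ (n + 1)) (hx : orderOf x = 2 ^ (n + 1)) {a : α}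
    (ha : x a = a) :
    ∃ (y : Equiv.Perm (shortCyclePoints x (2 ^ (n + 1))))
      (f : shortCyclePoints x (2 ^ (n + 1)) × Equiv.Perm (Fin 2) ≃ α),
      (∀ b, (y b : α) = shortCycleProduct x (2 ^ (n + 1)) b) ∧ (∀ b, f (b, 1) = b) ∧
        subnormalizer x = wreathS2 (subnormalizer y) f := by
  obtain ⟨d, hd⟩ := exists_minimalPeriod_eq_of_orderOf hx
  have hm : 1 < 2 ^ (n + 1) := Nat.one_lt_two_pow n.succ_ne_zero
  have hΩ := ncard_shortCyclePoints hα hm ha hd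
  have hinv := MulAction.mem_stabilizer_set.mp (smul_shortCyclePoints x (2 ^ (n + 1)))
  obtain ⟨f, hf, hsub⟩ := exists_subnormalizer_eq_wreathS2 (hx ▸ pow_orderOf_eq_one x) hinv
    (sameCycle_of_mem_compl_shortCyclePoints hα hm ha hd)
    (hΩ.trans (ncard_compl_eq_of_card_eq_two_mul hα hΩ).symm)
    (Set.nonempty_of_ncard_ne_zero (by lia)) ha
  exact ⟨x.subtypePerm hinv, f, fun b => (shortCycleProduct_apply b.2).symm, hf, hsub⟩

theorem isCycle_or_orderOf_eq_of_subnormalizer_ne_top [Fintype α] [DecidableEq α] {n m : ℕ}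
    {x : Equiv.Perm α} (hα : Fintype.card α = 2 ^ (n + 2)) (hx : x ^ 2 ^ m = 1)
    (h : subnormalizer x ≠ ⊤) :
    (x.IsCycle ∧ x.support.card = 2 ^ (n + 2)) ∨ (orderOf x = 2 ^ (n + 1) ∧ ∃ a, x a = a) := by
  refine (isCycle_or_pow_eq_one hα hx).imp_right fun hpow => ?_
  have hα' : Nat.card α = 2 ^ (n + 2) := Nat.card_eq_fintype_card.trans hα
  have hne := mt (subnormalizer_eq_top_of_pow_eq_one (n + 1) hα' hpow) h
  push Not at hne
  exact ⟨orderOf_eq_prime_pow hne.1 hpow, hne.2⟩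

end TwoPowerDegree

theorem mainTheorem3_general {α : Type*} [Fintype α] [DecidableEq α] {k : ℕ} (hk : 2 ≤ k)
    (hα : Fintype.card α = 2 ^ k) (x : Equiv.Perm α) (hx : ∃ m : ℕ, orderOf x = 2 ^ m) :
    (subnormalizer x < ⊤ ↔
      (x.IsCycle ∧ x.support.card = 2 ^ k) ∨
      (orderOf x = 2 ^ (k - 1) ∧ ∃ a, x a = a)) ∧
    ((orderOf x = 2 ^ (k - 1) ∧ ∃ a, x a = a) →
      ∃ (y : Equiv.Perm (shortCyclePoints x (2 ^ (k - 1))))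
        (f : shortCyclePoints x (2 ^ (k - 1)) × Equiv.Perm (Fin 2) ≃ α),
        (∀ a, (y a : α) = shortCycleProduct x (2 ^ (k - 1)) a) ∧
        (∀ a, f (a, 1) = a) ∧
        subnormalizer x = wreathS2 (subnormalizer y) f) := by
  obtain ⟨n, rfl⟩ := Nat.exists_eq_add_of_le' hk
  obtain ⟨m, hm⟩ := hx
  have hx1 : x ^ 2 ^ m = 1 := hm ▸ pow_orderOf_eq_one x
  have hα2 : Nat.card α = 2 * 2 ^ (n + 1) := by rw [Nat.card_eq_fintype_card, hα]; ring
  have hα3 : 3 ≤ Fintype.card α :=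
    hα ▸ le_trans (by norm_num) (Nat.pow_le_pow_right two_pos hk)
  rw [lt_top_iff_ne_top]
  refine ⟨⟨isCycle_or_orderOf_eq_of_subnormalizer_ne_top hα hx1, ?_⟩, ?_⟩
  · rintro (⟨hcyc, hcard⟩ | ⟨ho, a, ha⟩)
    · exact subnormalizer_ne_top_of_isCycle hα3 hx1 hcyc (hcard.trans hα.symm)
    · exact subnormalizer_ne_top_of_orderOf hα2 ho ha
  · rintro ⟨ho, a, ha⟩
    exact exists_subnormalizer_eq_wreathS2_shortCycleProduct hα2 ho ha

theorem mainTheorem3 (k : ℕ) (hk : 3 ≤ k) (x : Equiv.Perm (Fin (2 ^ k)))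
    (hx : ∃ m : ℕ, orderOf x = 2 ^ m) :
    (subnormalizer x < ⊤ ↔
      (x.IsCycle ∧ x.support.card = 2 ^ k) ∨
      (orderOf x = 2 ^ (k - 1) ∧ ∃ a, x a = a)) ∧
    ((orderOf x = 2 ^ (k - 1) ∧ ∃ a, x a = a) →
      ∃ (y : Equiv.Perm (shortCyclePoints x (2 ^ (k - 1))))
        (f : shortCyclePoints x (2 ^ (k - 1)) × Equiv.Perm (Fin 2) ≃ Fin (2 ^ k)),
        (∀ a, (y a : Fin (2 ^ k)) = shortCycleProduct x (2 ^ (k - 1)) a) ∧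
        (∀ a, f (a, 1) = a) ∧
        subnormalizer x = wreathS2 (subnormalizer y) f) :=
  mainTheorem3_general (by lia) (Fintype.card_fin _) x hx
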